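/- Let $k_1,k_2\ge 1$ be integers, $k=k_1+k_2$, and let $n\ge 2k$ (so $n\ge 2k\ge 4$). Let $\xi_1,\dots,\xi_n$ be independent Bernoulli trials with common success probability $p\in[0,1]$, i.e. $\mathbb P(\xi_l=1)=p=1-\mathbb P(\xi_l=0)$, and let $$B^n_{k_1,k_2}=\sum_{l=1}^{n-k+1}I_l,\qquad I_l=(1-\xi_l)\cdots(1-\xi_{l+k_1-1})\,\xi_{l+k_1}\cdots\xi_{l+k_1+k_2-1}.$$ Put $$a(p)=\mathbb E(I_l)=(1-p)^{k_1}p^{k_2},\qquad k^\star=\Big(\frac{k}{k-1}\Big)^{k-1},\qquad \tilde p=k\,a(p)\,k^\star .$$ Let $\alpha\ge 1$ be real and $0<\check p<1$, $\check q=1-\check p$, and let $Z$ have the pseudo-binomial distribution with parameters $\alpha,\check p$, that is $$\mathbb P(Z=m)=\frac1{\mathcal C}\binom{\alpha}{m}\check p^{\,m}\check q^{\,\alpha-m},\quad m=0,1,\dots,\lfloor\alpha\rfloor,\qquad \mathcal C=\sum_{m=0}^{\lfloor\alpha\rfloor}\binom{\alpha}{m}\check p^{\,m}\check q^{\,\alpha-m},$$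 where $\binom{\alpha}{m}=\alpha(\alpha-1)\cdots(\alpha-m+1)/m!$. Suppose that $\tilde p<1/2$ and that $\alpha\check p=(n-k+1)\,a(p)$. Then $$d_{TV}\big(B^n_{k_1,k_2},Z\big)\le\frac{a(p)}{\lfloor\alpha\rfloor\check p\check q}\left\{\big(n(2k^\star-1)+k-1\big)\frac{|\tilde p-\check p|}{1-2\tilde p}+\big(n(k(k^\star-2)+1)-k(k-1)k^\star+3k^2-4k+1\big)a(p)\right\},$$ where $d_{TV}(X,Y)=\sup_{S}|\mathbb P(X\in S)-\mathbb P(Y\in S)|$, the supremum being over all sets $S$ of non-negative integers. -/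

import Mathlib

open MeasureTheory ProbabilityTheory

noncomputable section

namespace PseudoBinomialRuns

/-- Total variation distance `sup_S |P(S) - Q(S)|`, over measurable sets `S`, between two
finite measures on the same space. -/
def dTV {E : Type*} [MeasurableSpace E] (P Q : Measure E) : ℝ :=
  ⨆ S : {S : Set E // MeasurableSet S}, |P.real S - Q.real S|

/-- The indicator `I_l = (1 - ξ_l) ⋯ (1 - ξ_{l+k₁-1}) ξ_{l+k₁} ⋯ ξ_{l+k₁+k₂-1}` of
`k₁` failures at `l, …, l+k₁-1` followed by `k₂` successes.  The trials take values in `{0, 1}`,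
for which the natural-number subtraction `1 - ξ` is the usual one. -/
def runIndicator {Ω : Type*} (k₁ k₂ : ℕ) (ξ : ℕ → Ω → ℕ) (l : ℕ) (ω : Ω) : ℕ :=
  (∏ j ∈ Finset.range k₁, (1 - ξ (l + j) ω)) * ∏ j ∈ Finset.range k₂, ξ (l + k₁ + j) ω

/-- The number `B = I_1 + ⋯ + I_{n-k₁-k₂+1}` of `(k₁, k₂)`-events in the trials `ξ_1, …, ξ_n`. -/
def runCount {Ω : Type*} (n k₁ k₂ : ℕ) (ξ : ℕ → Ω → ℕ) (ω : Ω) : ℕ :=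
  ∑ l ∈ Finset.Icc 1 (n + 1 - (k₁ + k₂)), runIndicator k₁ k₂ ξ l ω

/-- `a(p) = (1 - p)^{k₁} p^{k₂}`. -/
def runProb (k₁ k₂ : ℕ) (p : ℝ) : ℝ := (1 - p) ^ k₁ * p ^ k₂

/-- `k⋆ = (k / (k - 1))^{k - 1}`, for `k ≥ 2`. -/
def kStar (k : ℕ) : ℝ := ((k : ℝ) / ((k : ℝ) - 1)) ^ (k - 1)

/-- The unnormalised pseudo-binomial weight `(α choose m) p^m (1 - p)^{α - m}`, with the generalised
binomial coefficient `α (α - 1) ⋯ (α - m + 1) / m!` of a real number `α`. -/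
def pbWeight (α p : ℝ) (m : ℕ) : ℝ :=
  Ring.choose α m * p ^ m * (1 - p) ^ (α - (m : ℝ))

/-- The normalising constant `C = ∑_{m=0}^{⌊α⌋} (α choose m) p^m (1 - p)^{α - m}`. -/
def pbConst (α p : ℝ) : ℝ :=
  ∑ m ∈ Finset.range (⌊α⌋₊ + 1), pbWeight α p m

/-- The pseudo-binomial distribution with parameters `α > 0` and `0 < p < 1`: mass
`C⁻¹ (α choose m) p^m (1 - p)^{α - m}` at each `m = 0, 1, …, ⌊α⌋`. -/
def pseudoBinomial (α p : ℝ) : Measure ℕ :=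
  ∑ m ∈ Finset.range (⌊α⌋₊ + 1), ENNReal.ofReal (pbWeight α p m / pbConst α p) • Measure.dirac m

end PseudoBinomialRuns

end

/-!
The count `B` of `(k₁, k₂)`-runs in `n` trials has the law of a sum of independent Bernoulli
variables, and for such sums Stein's method for the pseudo-binomial law is exact enough.

Put `k = k₁ + k₂`. Two runs never overlap, so conditioning on whether a run ends at trial `n` gives
`E h(Bₙ) = E h(Bₙ₋₁) + a E Δh(Bₙ₋ₖ)` for every `h`, where `Δ` is the forward difference. Hence
`E h(Bₙ) = (φₙ(a Δ) h)(0)` with the polynomials `φₙ = φₙ₋₁ + X φₙ₋ₖ`, `φₙ = 1` for `n < k`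
(`integral_comp_runCount_eq_aeval`). These polynomials are real-rooted: in the upper half plane the
arguments of `φᵢ(z), …, φᵢ₊ₖ₋₁(z)` increase within a sector of angle `arg z`
(`aeval_runPoly_cone`), a property that the recursion propagates and that excludes zeros. They are
positive on `[-1 / (k k⋆), ∞)`, since there `φₙ₊₁ ≥ (1 - 1 / k) φₙ` (`eval_runPoly_pos`). So
`φₙ = ∏ (1 + sᵢ X)` with `0 ≤ sᵢ ≤ k k⋆`, and `1 + sᵢ a Δ` is the averaging operator of a Bernoulli
variable of parameter `θᵢ = a sᵢ ≤ p̃`. Thus `B` is distributed as a sum of independent Bernoulli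
variables with parameters `θᵢ`, and the first coefficients of `φₙ` give `∑ θᵢ` and `∑ θᵢ²`
(`exists_runPoly_eq_prod`).

Write now `p`, `α` for the parameters of the pseudo-binomial law. For such a sum, of mean `α p`, and
the Stein operator `𝒜g(m) = α p g(m + 1) - m (g(m) + p Δg(m))` one has
`|E 𝒜g(B)| ≤ sup |Δg| ∑ θᵢ |p - θᵢ|` (`abs_bernoulliSum_stein_le`), and
`∑ θᵢ |p - θᵢ| ≤ α p |p̃ - p| + ∑ θᵢ (p̃ - θᵢ)`, where the last sum is `a²` times the second
coefficient in the claim. It remains to solve the Stein equation. On `{0, …, ⌊α⌋}` this is the usual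
birth and death computation, with `|Δg| ≤ 1 / ((α + 1) p (1 - p))`. But `B` may exceed `⌊α⌋`, and
for non-integral `α` the Stein operator does not leave the pseudo-binomial law invariant. Both
defects are met by continuing `g` beyond `⌊α⌋` by a suitable constant: the Stein equation becomes an
inequality with an error supported at the single point `⌊α⌋` (`sub_le_steinSolution`), which `B`
hits with probability at most `1 / 2` (`bernoulliSum_single_le_half`). The gap between
`1 / ((α + 1) p (1 - p))` and `1 / (⌊α⌋ p (1 - p))` absorbs this error (`error_le`), because
`2 k - 1 ≤ (3 / 4) k k⋆`. All this needs `p ≤ 1 / 2`; for `p > 1 / 2` the bound exceeds `1`.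
-/

namespace PseudoBinomialRuns

/-! ### The polynomials of the run count and their roots -/

section
open Polynomial ComplexConjugate

/-- The polynomials `φₙ` with `φₙ = φₙ₋₁ + X φₙ₋ₖ` for `n ≥ k` and `φₙ = 1` for `n < k`. The condition
`0 < k` only serves termination. -/
noncomputable def runPoly (k n : ℕ) : ℝ[X] :=
  if _h : 0 < k ∧ k ≤ n then runPoly k (n - 1) + X * runPoly k (n - k) else 1
termination_by n
decreasing_by all_goals omega

lemma runPoly_of_lt {k n : ℕ} (h : n < k) : runPoly k n = 1 := by
  rw [runPoly, dif_neg (by omega)]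

lemma runPoly_of_le {k n : ℕ} (hk : 0 < k) (h : k ≤ n) :
    runPoly k n = runPoly k (n - 1) + X * runPoly k (n - k) := by
  rw [runPoly, dif_pos ⟨hk, h⟩]

/-- For `z` in the upper half plane, the values at `z` of up to `k` consecutive polynomials have
arguments that increase and stay within a sector of angle `arg z`; in particular they are nonzero.
The two inequalities say that `φₙ(z) / φᵢ(z)` lies in the cone `0 ≤ arg ≤ arg z`. -/
lemma aeval_runPoly_cone {k : ℕ} (hk : 0 < k) {z : ℂ} (hz : 0 < z.im) (n : ℕ) :
    aeval z (runPoly k n) ≠ 0 ∧ ∀ i ≤ n, n < i + k →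
      0 ≤ (aeval z (runPoly k n) * conj (aeval z (runPoly k i))).im ∧
      0 ≤ (z * aeval z (runPoly k i) * conj (aeval z (runPoly k n))).im := by
  have hself : ∀ w : ℂ, (w * conj w).im = 0 ∧ (z * w * conj w).im = z.im * Complex.normSq w := by
    intro w
    constructor
    · simp; ring
    · simp [Complex.normSq_apply]; ring
  induction n using Nat.strong_induction_on with
  | _ n ih =>
    rcases lt_or_ge n k with hnk | hnk
    · refine ⟨by simp [runPoly_of_lt hnk], fun i hi _ => ?_⟩
      simp [runPoly_of_lt hnk, runPoly_of_lt (lt_of_le_of_lt hi hnk), hz.le]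
    · have hrec : aeval z (runPoly k n) =
          aeval z (runPoly k (n - 1)) + z * aeval z (runPoly k (n - k)) := by
        rw [runPoly_of_le hk hnk]; simp
      have h0 := ih (n - k) (by omega)
      have h1 := ih (n - 1) (by omega)
      have e1 : ∀ u v w : ℂ, ((u + z * v) * conj w).im
          = (u * conj w).im + (z * v * conj w).im := by
        intro u v w; simp; ring
      have e2 : ∀ u v w : ℂ, (z * w * conj (u + z * v)).im
          = (z * w * conj u).im + Complex.normSq z * (w * conj v).im := by
        intro u v w; simp [Complex.normSq_apply]; ring
      have hpos : 0 < (aeval z (runPoly k n) * conj (aeval z (runPoly k (n - k)))).im := by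
        rw [hrec, e1, (hself _).2]
        have := (h1.2 (n - k) (by omega) (by omega)).1
        have := mul_pos hz (Complex.normSq_pos.2 h0.1)
        linarith
      refine ⟨fun h => by simp [h] at hpos, fun i hi hik => ?_⟩
      rcases hi.eq_or_lt with rfl | hi
      · rw [(hself _).1, (hself _).2]
        exact ⟨le_rfl, mul_nonneg hz.le (Complex.normSq_nonneg _)⟩
      · have ha := h1.2 i (by omega) (by omega)
        have hb := (ih i hi).2 (n - k) (by omega) (by omega)
        rw [hrec, e1, e2]
        exact ⟨add_nonneg ha.1 hb.2,
          add_nonneg ha.2 (mul_nonneg (Complex.normSq_nonneg z) hb.1)⟩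

lemma im_eq_zero_of_aeval_runPoly_eq_zero {k : ℕ} (hk : 0 < k) (n : ℕ) {z : ℂ}
    (h : aeval z (runPoly k n) = 0) : z.im = 0 := by
  rcases lt_trichotomy z.im 0 with hz | hz | hz
  · have : aeval (conj z) (runPoly k n) = 0 := by
      rw [aeval_conj, h, map_zero]
    exact absurd this (aeval_runPoly_cone hk (by simpa using hz) n).1
  · exact hz
  · exact absurd h (aeval_runPoly_cone hk hz n).1

lemma kStar_pos {k : ℕ} (hk : 2 ≤ k) : 0 < kStar k := by
  have : (2 : ℝ) ≤ k := by exact_mod_cast hk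
  exact pow_pos (div_pos (by linarith) (by linarith)) _

/-- Positivity of `φₙ` on `[-1 / (k k⋆), ∞)`: there consecutive values decrease at most by the factor
`r = (k - 1) / k`, and `k⋆ = r ^ (-(k - 1))`. -/
lemma eval_runPoly_pos {k : ℕ} (hk : 2 ≤ k) {x : ℝ} (hx : -1 ≤ x * (k * kStar k)) (n : ℕ) :
    0 < (runPoly k n).eval x ∧
      ((k : ℝ) - 1) / k * (runPoly k n).eval x ≤ (runPoly k (n + 1)).eval x := by
  have hk2 : (2 : ℝ) ≤ k := by exact_mod_cast hk
  set r : ℝ := ((k : ℝ) - 1) / k with hr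
  have hr0 : 0 < r := div_pos (by linarith) (by linarith)
  have hr1 : r ≤ 1 := by rw [hr, div_le_one (by linarith)]; linarith
  have hK : kStar k * r ^ (k - 1) = 1 := by
    rw [kStar, ← mul_pow, hr, div_mul_div_comm, mul_comm, div_self, one_pow]
    have : (k : ℝ) - 1 ≠ 0 := by linarith
    positivity
  induction n using Nat.strong_induction_on with
  | _ n ih =>
    have hn : 0 < (runPoly k n).eval x := by
      rcases Nat.eq_zero_or_pos n with rfl | h
      · rw [runPoly_of_lt (by omega)]; simp
      · obtain ⟨h1, h2⟩ := ih (n - 1) (by omega)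
        rw [Nat.sub_add_cancel h] at h2
        exact lt_of_lt_of_le (mul_pos hr0 h1) h2
    refine ⟨hn, ?_⟩
    rcases lt_or_ge (n + 1) k with h | h
    · rw [runPoly_of_lt h, runPoly_of_lt (by omega)]; simpa using hr1
    · have hstep : ∀ j, j ≤ k - 1 →
          r ^ j * (runPoly k (n + 1 - k)).eval x ≤ (runPoly k (n + 1 - k + j)).eval x := by
        intro j hj
        induction j with
        | zero => simp
        | succ j ihj =>
          have := (ih (n + 1 - k + j) (by omega)).2
          have h3 := mul_le_mul_of_nonneg_left (ihj (by omega)) hr0.le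
          rw [pow_succ', mul_assoc]
          exact h3.trans this
      have h4 := hstep (k - 1) le_rfl
      rw [show n + 1 - k + (k - 1) = n by omega] at h4
      have h5 : (runPoly k (n + 1 - k)).eval x ≤ kStar k * (runPoly k n).eval x := by
        have := mul_le_mul_of_nonneg_left h4 (kStar_pos hk).le
        rwa [← mul_assoc, hK, one_mul] at this
      have h6 : 0 < (runPoly k (n + 1 - k)).eval x := by
        rcases eq_or_lt_of_le (show n + 1 - k ≤ n by omega) with h' | h'
        · rw [h']; exact hn
        · exact (ih _ h').1
      rw [runPoly_of_le (by omega) h]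
      simp only [Nat.add_sub_cancel, eval_add, eval_mul, eval_X]
      have hks := kStar_pos hk
      -- `x ≥ -1/(k k⋆)` and `φ_{n+1-k} ≤ k⋆ φ_n` give `x φ_{n+1-k} ≥ -φ_n / k`.
      have h7 : -((runPoly k n).eval x / k) ≤ x * (runPoly k (n + 1 - k)).eval x := by
        rcases le_or_gt 0 x with h0 | h0
        · have : 0 ≤ (runPoly k n).eval x / k := by positivity
          have := mul_nonneg h0 h6.le
          linarith
        · have h8 := mul_le_mul_of_nonpos_left h5 h0.le
          refine le_trans ?_ h8
          rw [← neg_div, div_le_iff₀ (by linarith)]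
          nlinarith
      have : r * (runPoly k n).eval x = (runPoly k n).eval x - (runPoly k n).eval x / k := by
        rw [hr]; field_simp
      linarith

/-- A real polynomial with value `1` at `0`, all of whose complex roots are real and less than
`-1 / K`, is a product of factors `1 + x X` with `0 ≤ x ≤ K`. -/
lemma eq_prod_of_roots_le {K : ℝ} (hK : 0 < K) (P : ℝ[X]) (h0 : P.eval 0 = 1)
    (hroot : ∀ z : ℂ, aeval z P = 0 → z.im = 0)
    (hpos : ∀ x : ℝ, -1 ≤ x * K → P.eval x ≠ 0) :
    ∃ s : List ℝ, (∀ x ∈ s, 0 ≤ x ∧ x ≤ K) ∧ P = (s.map fun x => 1 + C x * X).prod := by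
  induction hd : P.natDegree using Nat.strong_induction_on generalizing P with
  | _ d ih =>
    rcases Nat.eq_zero_or_pos d with rfl | hdpos
    · refine ⟨[], by simp, ?_⟩
      rw [eq_C_of_natDegree_eq_zero hd] at h0 ⊢
      simp at h0 ⊢
      rw [h0, map_one]
    · obtain ⟨z, hz⟩ := IsAlgClosed.exists_aeval_eq_zero ℂ P
        (natDegree_pos_iff_degree_pos.1 (by omega)).ne'
      have hzr : z = (z.re : ℂ) := Complex.ext rfl (by simpa using hroot z hz)
      set r := z.re
      have hr : P.eval r = 0 := by
        rw [hzr] at hz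
        have := aeval_algebraMap_apply ℂ r P
        simp only [Complex.coe_algebraMap] at this
        rw [hz] at this
        simpa using this.symm
      have hrK : r * K < -1 := by
        by_contra h
        exact hpos r (not_lt.1 h) hr
      have hr0 : r < 0 := by nlinarith
      obtain ⟨Q, hQ⟩ := dvd_iff_isRoot.2 hr
      have hPne : P ≠ 0 := fun h => by simp [h] at h0
      have hQne : Q ≠ 0 := fun h => hPne (by rw [hQ, h, mul_zero])
      have hfac : P = (1 + C (-r⁻¹) * X) * (C (-r) * Q) := by
        rw [hQ]
        have : C (-r⁻¹) * C (-r) = (1 : ℝ[X]) := by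
          rw [← C_mul, neg_mul_neg, inv_mul_cancel₀ hr0.ne, map_one]
        have e : (1 + C (-r⁻¹) * X) * (C (-r) * Q)
            = (C (-r) + (C (-r⁻¹) * C (-r)) * X) * Q := by ring
        rw [e, this, one_mul, C_neg]; ring
      obtain ⟨s, hs, hsQ⟩ := ih (C (-r) * Q).natDegree (by
          rw [natDegree_C_mul (by simpa using hr0.ne), ← hd, hQ,
            natDegree_mul (X_sub_C_ne_zero r) hQne, natDegree_X_sub_C]; omega)
        (C (-r) * Q) (by rw [hfac] at h0; simpa using h0)
        (fun w hw => hroot w (by rw [hfac, map_mul, hw, mul_zero]))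
        (fun x hx h => hpos x hx (by rw [hfac, eval_mul, h, mul_zero])) rfl
      refine ⟨-r⁻¹ :: s, ?_, by rw [hfac, hsQ]; simp⟩
      intro x hx
      rcases List.mem_cons.1 hx with rfl | hx
      · have h1 : r⁻¹ < 0 := inv_lt_zero.2 hr0
        refine ⟨by linarith, ?_⟩
        have : r⁻¹ * (r * K) = K := inv_mul_cancel_left₀ hr0.ne K
        nlinarith
      · exact hs x hx

lemma coeff_runPoly {k : ℕ} (hk : 0 < k) (n : ℕ) :
    (runPoly k n).coeff 0 = 1 ∧ (n < k → (runPoly k n).coeff 1 = 0) ∧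
    (k ≤ n + 1 → (runPoly k n).coeff 1 = n + 1 - k) ∧
    (n < 2 * k → (runPoly k n).coeff 2 = 0) ∧
    (2 * k ≤ n + 1 → 2 * (runPoly k n).coeff 2 = ((n : ℝ) + 2 - 2 * k) * (n + 1 - 2 * k)) := by
  induction n using Nat.strong_induction_on with
  | _ n ih =>
    rcases lt_or_ge n k with hnk | hnk
    · rw [runPoly_of_lt hnk]
      refine ⟨by simp, fun _ => by simp [coeff_one], fun h => ?_, fun _ => by simp [coeff_one],
        fun h => ?_⟩
      · have : k = n + 1 := by omega
        simp [coeff_one, this]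
      · have h1 : k = 1 := by omega
        have h2 : n = 0 := by omega
        subst h1 h2
        norm_num [coeff_one]
    · obtain ⟨a0, -, a2, a3, a4⟩ := ih (n - 1) (by omega)
      obtain ⟨b0, b1, b2, -, -⟩ := ih (n - k) (by omega)
      have c1 : ((n - 1 : ℕ) : ℝ) = n - 1 := by rw [Nat.cast_sub (by omega)]; simp
      have c2 : ((n - k : ℕ) : ℝ) = n - k := by rw [Nat.cast_sub (by omega)]
      rw [runPoly_of_le hk hnk]
      simp only [coeff_add, coeff_X_mul_zero, coeff_X_mul]
      rw [c1] at a2 a4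
      rw [c2] at b2
      refine ⟨by rw [a0, add_zero], fun h => by omega, fun h => ?_, fun h => ?_, fun h => ?_⟩
      · rw [a2 (by omega), b0]; ring
      · rw [a3 (by omega), b1 (by omega), add_zero]
      · rcases h.eq_or_lt with h' | h'
        · rw [a3 (by omega), b1 (by omega)]
          have : (2 * k : ℝ) = n + 1 := by exact_mod_cast h'
          rw [this]; ring
        · rw [mul_add, a4 (by omega), b2 (by omega)]; ring

lemma coeff_prod_one_add_C_mul_X (s : List ℝ) :
    (s.map fun x => 1 + C x * X).prod.coeff 0 = 1 ∧
    (s.map fun x => 1 + C x * X).prod.coeff 1 = s.sum ∧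
    2 * (s.map fun x => 1 + C x * X).prod.coeff 2 = s.sum ^ 2 - (s.map fun x => x ^ 2).sum := by
  induction s with
  | nil => simp [coeff_one]
  | cons x s ih =>
    obtain ⟨h0, h1, h2⟩ := ih
    have e0 : ∀ P : ℝ[X], ((1 + C x * X) * P).coeff 0 = P.coeff 0 := by
      intro P; rw [add_mul, one_mul, mul_assoc, coeff_add, coeff_C_mul, coeff_X_mul_zero]; ring
    have e : ∀ (P : ℝ[X]) (j : ℕ),
        ((1 + C x * X) * P).coeff (j + 1) = P.coeff (j + 1) + x * P.coeff j := by
      intro P j; rw [add_mul, one_mul, mul_assoc, coeff_add, coeff_C_mul, coeff_X_mul]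
    have e1 := e (s.map fun x => 1 + C x * X).prod 0
    have e2 := e (s.map fun x => 1 + C x * X).prod 1
    simp only [zero_add, one_add_one_eq_two] at e1 e2
    simp only [List.map_cons, List.prod_cons, List.sum_cons]
    refine ⟨by rw [e0, h0], by rw [e1, h1, h0]; ring, ?_⟩
    rw [e2, mul_add, h2, h1]; ring

lemma exists_runPoly_eq_prod {k n : ℕ} (hk : 2 ≤ k) (hn : 2 * k ≤ n) :
    ∃ s : List ℝ, (∀ x ∈ s, 0 ≤ x ∧ x ≤ k * kStar k) ∧
      runPoly k n = (s.map fun x => 1 + C x * X).prod ∧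
      s.sum = n - k + 1 ∧
      (s.map fun x => x ^ 2).sum = ((n : ℝ) - k + 1) * (2 * k - 1) - k * (k - 1) := by
  have hk0 : 0 < k := by omega
  obtain ⟨c0, -, c1, -, c2⟩ := coeff_runPoly hk0 n
  obtain ⟨s, hs, hP⟩ := eq_prod_of_roots_le (K := k * kStar k)
    (mul_pos (by exact_mod_cast hk0) (kStar_pos hk)) (runPoly k n)
    (by rw [← coeff_zero_eq_eval_zero, c0]) (fun z => im_eq_zero_of_aeval_runPoly_eq_zero hk0 n)
    (fun x hx => (eval_runPoly_pos hk hx n).1.ne')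
  obtain ⟨-, d1, d2⟩ := coeff_prod_one_add_C_mul_X s
  rw [← hP] at d1 d2
  have hsum : s.sum = n - k + 1 := by rw [← d1, c1 (by omega)]; ring
  refine ⟨s, hs, hP, hsum, ?_⟩
  rw [c2 (by omega), hsum] at d2
  linarith

end

/-! ### Sums of independent Bernoulli variables -/

section
open Polynomial

/-- The expectation of `h` at a sum of independent Bernoulli variables whose parameters are listed. -/
noncomputable def bernoulliSum : List ℝ → (ℕ → ℝ) → ℝ
  | [], h => h 0
  | t :: l, h => (1 - t) * bernoulliSum l h + t * bernoulliSum l fun m => h (m + 1)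

lemma bernoulliSum_add (l : List ℝ) (g h : ℕ → ℝ) :
    bernoulliSum l (fun m => g m + h m) = bernoulliSum l g + bernoulliSum l h := by
  induction l generalizing g h with
  | nil => rfl
  | cons t l ih => simp only [bernoulliSum, ih]; ring

lemma bernoulliSum_const_mul (l : List ℝ) (c : ℝ) (h : ℕ → ℝ) :
    bernoulliSum l (fun m => c * h m) = c * bernoulliSum l h := by
  induction l generalizing h with
  | nil => rfl
  | cons t l ih => simp only [bernoulliSum, ih]; ring

lemma bernoulliSum_sub (l : List ℝ) (g h : ℕ → ℝ) :
    bernoulliSum l (fun m => g m - h m) = bernoulliSum l g - bernoulliSum l h := by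
  induction l generalizing g h with
  | nil => rfl
  | cons t l ih => simp only [bernoulliSum, ih]; ring

lemma bernoulliSum_const (l : List ℝ) (c : ℝ) : bernoulliSum l (fun _ => c) = c := by
  induction l with
  | nil => rfl
  | cons t l ih => simp only [bernoulliSum, ih]; ring

lemma bernoulliSum_mono {l : List ℝ} (hl : ∀ t ∈ l, 0 ≤ t ∧ t ≤ 1) {g h : ℕ → ℝ}
    (hgh : ∀ m, g m ≤ h m) : bernoulliSum l g ≤ bernoulliSum l h := by
  induction l generalizing g h with
  | nil => exact hgh 0
  | cons t l ih =>
    have ht := hl t (by simp)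
    have hl' : ∀ t ∈ l, 0 ≤ t ∧ t ≤ 1 := fun x hx => hl x (by simp [hx])
    exact add_le_add (mul_le_mul_of_nonneg_left (ih hl' hgh) (by linarith))
      (mul_le_mul_of_nonneg_left (ih hl' fun m => hgh (m + 1)) ht.1)

/-- Stein bound for a sum of independent Bernoulli variables: by induction on the
list, a parameter `t` contributes `t (t - p)` times the mean of an increment of `g`. -/
lemma abs_bernoulliSum_stein_le {l : List ℝ} (hl : ∀ t ∈ l, 0 ≤ t ∧ t ≤ 1) (p : ℝ) {H : ℝ}
    {g : ℕ → ℝ} (hg : ∀ j, 1 ≤ j → |g (j + 1) - g j| ≤ H) :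
    |bernoulliSum l fun m => l.sum * g (m + 1) - m * (g m + p * (g (m + 1) - g m))|
      ≤ H * (l.map fun t => t * |p - t|).sum := by
  induction l generalizing g with
  | nil => simp [bernoulliSum]
  | cons t l ih =>
    have ht := hl t (by simp)
    have hl' : ∀ t ∈ l, 0 ≤ t ∧ t ≤ 1 := fun x hx => hl x (by simp [hx])
    have i1 := ih hl' hg
    have i2 := ih hl' (g := fun m => g (m + 1)) fun j hj => hg (j + 1) (by omega)
    have i3 : |bernoulliSum l fun m => g (m + 2) - g (m + 1)| ≤ H := by
      have hb := fun m => abs_le.1 (hg (m + 1) (by omega))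
      have u := bernoulliSum_mono hl' fun m => (hb m).1
      have v := bernoulliSum_mono hl' fun m => (hb m).2
      rw [bernoulliSum_const] at u v
      exact abs_le.2 ⟨u, v⟩
    have key : bernoulliSum (t :: l) (fun m =>
          (t :: l).sum * g (m + 1) - m * (g m + p * (g (m + 1) - g m)))
        = (1 - t) * bernoulliSum l (fun m =>
            l.sum * g (m + 1) - m * (g m + p * (g (m + 1) - g m)))
          + t * bernoulliSum l (fun m =>
            l.sum * g (m + 2) - m * (g (m + 1) + p * (g (m + 2) - g (m + 1))))
          + t * (t - p) * bernoulliSum l (fun m => g (m + 2) - g (m + 1)) := by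
      simp only [bernoulliSum, ← bernoulliSum_const_mul, ← bernoulliSum_add]
      congr 1
      funext m
      push_cast [List.sum_cons]
      ring
    rw [key, List.map_cons, List.sum_cons, mul_add]
    have j1 := mul_le_mul_of_nonneg_left i1 (show 0 ≤ 1 - t by linarith)
    have j2 := mul_le_mul_of_nonneg_left i2 ht.1
    have j3 := mul_le_mul_of_nonneg_left i3 (show 0 ≤ t * |p - t| from
      mul_nonneg ht.1 (abs_nonneg _))
    refine (abs_add_le _ _).trans ((add_le_add_left (abs_add_le _ _) _).trans ?_)
    rw [abs_mul, abs_mul, abs_mul, abs_mul, abs_of_nonneg ht.1,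
      abs_of_nonneg (show 0 ≤ 1 - t by linarith), abs_sub_comm t p]
    linarith

/-- A sum of independent Bernoulli variables with parameters at most `1 / 2` takes any given positive
value with probability at most `1 / 2`. -/
lemma bernoulliSum_single_le_half {l : List ℝ} (hl : ∀ t ∈ l, 0 ≤ t ∧ t ≤ 1 / 2) (N : ℕ) :
    bernoulliSum l (fun m => if m = N + 1 then 1 else 0) ≤ 1 / 2 := by
  induction l generalizing N with
  | nil => norm_num [bernoulliSum]
  | cons t l ih =>
    have ht := hl t (by simp)
    have hl' : ∀ t ∈ l, 0 ≤ t ∧ t ≤ 1 / 2 := fun x hx => hl x (by simp [hx])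
    have hl1 : ∀ t ∈ l, 0 ≤ t ∧ t ≤ 1 := fun x hx => ⟨(hl' x hx).1, by linarith [(hl' x hx).2]⟩
    simp only [bernoulliSum, Nat.add_right_cancel_iff]
    have i1 := ih hl' N
    cases N with
    | zero =>
      -- `P(Y = 0) + P(Y = 1) ≤ 1` disposes of the part `2t` of the mixture.
      have h01 : bernoulliSum l (fun m => if m = 0 then 1 else 0)
          + bernoulliSum l (fun m => if m = 0 + 1 then 1 else 0) ≤ 1 := by
        rw [← bernoulliSum_add]
        refine (bernoulliSum_mono hl1 (h := fun _ => 1) fun m => ?_).trans_eq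
          (bernoulliSum_const l 1)
        rcases m with _ | _ | m <;> norm_num
      nlinarith
    | succ N =>
      have i2 := ih hl' N
      nlinarith

/-- The forward difference operator `h ↦ h (· + 1) - h`. -/
noncomputable def forwardDiff : (ℕ → ℝ) →ₗ[ℝ] (ℕ → ℝ) where
  toFun h m := h (m + 1) - h m
  map_add' g h := by funext m; simp; ring
  map_smul' c h := by funext m; simp; ring

/-- As `1 + t Δ` averages over a Bernoulli variable of parameter `t`, the product of such operators
averages over the sum. -/
lemma bernoulliSum_eq_aeval (s : List ℝ) (a : ℝ) (h : ℕ → ℝ) :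
    bernoulliSum (s.map fun x => a * x) h =
      aeval (R := ℝ) (A := Module.End ℝ (ℕ → ℝ)) (a • forwardDiff)
        (s.map fun x => 1 + C x * X).prod h 0 := by
  induction s generalizing h with
  | nil => simp [bernoulliSum]
  | cons x s ih =>
    have e : aeval (R := ℝ) (A := Module.End ℝ (ℕ → ℝ)) (a • forwardDiff) (1 + C x * X) h
        = (1 - a * x) • h + (a * x) • fun m => h (m + 1) := by
      funext m
      simp [forwardDiff, Algebra.algebraMap_eq_smul_one]
      ring
    rw [List.map_cons, List.map_cons, List.prod_cons, mul_comm (1 + C x * X), map_mul, Module.End.mul_apply, e,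
      map_add, map_smul, map_smul, bernoulliSum, ih, ih]
    rfl

end

/-! ### The Stein equation of the pseudo-binomial law -/

section
open Finset

/-- The algebra behind the bound for an increment of the Stein solution at `j`. In the application `F`,
`U`, `w` are the masses below, above and at `j`; `A`, `B`, `w * f` are the corresponding masses of
the test set; and `b`, `d` are the birth and death rates at `j`. -/
lemma abs_increment_le {F U w A B f b d p α : ℝ} (hp : 0 < p) (hp1 : p < 1)
    (hF : 0 ≤ F) (hU : 0 ≤ U) (hw : 0 ≤ w) (hA : 0 ≤ A) (hAF : A ≤ F) (hB : 0 ≤ B) (hBU : B ≤ U)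
    (hf : 0 ≤ f) (hf1 : f ≤ 1) (hone : F + U + w = 1) (hb : 0 < b) (hd : 0 < d) (hα : 0 < α)
    (hbd : b * (1 - p) + d * p = α * p * (1 - p))
    (h1 : U * (d + (1 - p)) ≤ b * (1 - F)) (h2 : F * (b + p) ≤ d * (1 - U)) :
    |((A + B + w * f) * U - B) / b - (A - (A + B + w * f) * F) / d|
      ≤ w * (1 / ((α + 1) * p * (1 - p))) := by
  obtain ⟨X, rfl⟩ : ∃ X, F = X * d := ⟨F / d, by field_simp⟩
  obtain ⟨Y, rfl⟩ : ∃ Y, U = Y * b := ⟨U / b, by field_simp⟩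
  have hX : 0 ≤ X := nonneg_of_mul_nonneg_left hF hd
  have hY : 0 ≤ Y := nonneg_of_mul_nonneg_left hU hb
  have h1' : Y * (d + (1 - p)) ≤ 1 - X * d := by
    refine le_of_mul_le_mul_left ?_ hb; linarith
  have h2' : X * (b + p) ≤ 1 - Y * b := by
    refine le_of_mul_le_mul_left ?_ hd; linarith
  have hq : 0 < 1 - p := by linarith
  have hα' : 0 < (α + 1) * p * (1 - p) := by positivity
  -- The combination `(1 - p) • h2' + p • h1'` has the same coefficient at `X` and at `Y`.
  have hXY : X + Y ≤ 1 / ((α + 1) * p * (1 - p)) := by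
    rw [le_div_iff₀ hα']
    have e : (X + Y) * ((α + 1) * p * (1 - p))
        = (1 - p) * (X * (b + p) + Y * b) + p * (Y * (d + (1 - p)) + X * d) := by
      linear_combination (-(X + Y)) * hbd
    rw [e]
    have := mul_le_mul_of_nonneg_left h2' hq.le
    have := mul_le_mul_of_nonneg_left h1' hp.le
    linarith
  have hd1 : X + Y ≤ 1 / d := by rw [le_div_iff₀ hd]; nlinarith
  have hb1 : X + Y ≤ 1 / b := by rw [le_div_iff₀ hb]; nlinarith
  have e : ((A + B + w * f) * (Y * b) - B) / b - (A - (A + B + w * f) * (X * d)) / d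
      = w * f * (X + Y) + A * (X + Y - 1 / d) + B * (X + Y - 1 / b) := by
    field_simp; ring
  have hw1 : w * (X + Y) ≤ w * (1 / ((α + 1) * p * (1 - p))) := mul_le_mul_of_nonneg_left hXY hw
  have hwf : w * f * (X + Y) ≤ w * (X + Y) :=
    mul_le_mul_of_nonneg_right (by nlinarith) (by linarith)
  have hwf0 : 0 ≤ w * f * (X + Y) := by positivity
  have lo : X * d * (X + Y - 1 / d) + Y * b * (X + Y - 1 / b) = -(w * (X + Y)) := by
    have : w = 1 - X * d - Y * b := by linarith
    rw [this]; field_simp; ring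
  rw [e, abs_le]
  constructor
  · have := mul_le_mul_of_nonpos_right hAF (sub_nonpos.2 hd1)
    have := mul_le_mul_of_nonpos_right hBU (sub_nonpos.2 hb1)
    linarith
  · have := mul_nonpos_of_nonneg_of_nonpos hA (sub_nonpos.2 hd1)
    have := mul_nonpos_of_nonneg_of_nonpos hB (sub_nonpos.2 hb1)
    linarith

section
variable {N : ℕ} {α p : ℝ} {w : ℕ → ℝ}

/-- Mass above `j`: the death rates there are at least that of `j + 1`, the birth rates at most that
of `j`. -/
lemma upper_tail_le (hαN : N ≤ α) (hp : 0 < p) (hp1 : p < 1) (hw : ∀ m ≤ N, 0 < w m)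
    (hbal : ∀ m < N, (m + 1) * (1 - p) * w (m + 1) = (α - m) * p * w m) {j : ℕ} (hj : j < N) :
    (∑ i ∈ Ico (j + 1) (N + 1), w i) * (j * (1 - p) + (1 - p))
      ≤ (α - j) * p * ∑ i ∈ Ico j (N + 1), w i := by
  have hjN : (j : ℝ) < N := by exact_mod_cast hj
  rw [← sum_Ico_add' w j N 1, sum_mul, sum_Ico_succ_top hj.le, mul_add, mul_sum]
  have : 0 ≤ (α - j) * p * w N :=
    mul_nonneg (mul_nonneg (by linarith) hp.le) (hw N le_rfl).le
  refine (sum_le_sum fun i hi => ?_).trans (le_add_of_nonneg_right this)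
  obtain ⟨hi1, hi2⟩ := mem_Ico.1 hi
  have hi1' : (j : ℝ) ≤ i := by exact_mod_cast hi1
  have h1 := hw i hi2.le
  have h2 := hw (i + 1) hi2
  have hb := hbal i hi2
  have e1 : (j * (1 - p) + (1 - p)) * w (i + 1) ≤ (i + 1) * (1 - p) * w (i + 1) :=
    mul_le_mul_of_nonneg_right (by nlinarith) h2.le
  have e2 : (α - i) * p * w i ≤ (α - j) * p * w i :=
    mul_le_mul_of_nonneg_right (by nlinarith) h1.le
  linarith

/-- Mass below `j`: the birth rates there are at least that of `j - 1`, the death rates at most that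
of `j`. -/
lemma lower_tail_le (hp : 0 < p) (hp1 : p < 1) (hw : ∀ m ≤ N, 0 < w m)
    (hbal : ∀ m < N, (m + 1) * (1 - p) * w (m + 1) = (α - m) * p * w m) {j : ℕ} (hj : j ≤ N) :
    (∑ i ∈ range j, w i) * ((α - j) * p + p) ≤ j * (1 - p) * ∑ i ∈ range (j + 1), w i := by
  rw [sum_range_succ', mul_add (_ * _) _ (w 0), sum_mul, mul_sum]
  have : 0 ≤ j * (1 - p) * w 0 :=
    mul_nonneg (mul_nonneg (by positivity) (by linarith)) (hw 0 (by omega)).le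
  refine (sum_le_sum fun i hi => ?_).trans (le_add_of_nonneg_right this)
  have hi2 := mem_range.1 hi
  have hi2' : (i : ℝ) + 1 ≤ j := by exact_mod_cast hi2
  have h1 := hw i (by omega)
  have h2 := hw (i + 1) (by omega)
  have hb := hbal i (by omega)
  have e1 : (i + 1) * (1 - p) * w (i + 1) ≤ j * (1 - p) * w (i + 1) :=
    mul_le_mul_of_nonneg_right (mul_le_mul_of_nonneg_right hi2' (by linarith)) h2.le
  have e2 : w i * ((α - j) * p + p) ≤ (α - i) * p * w i := by
    rw [mul_comm]
    exact mul_le_mul_of_nonneg_right (by nlinarith) h1.le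
  linarith

/-- The solution of the Stein equation
`(α - m) p g(m + 1) - m (1 - p) g(m) = f(m) - ∑ w f` on `{0, …, N}`, for weights `w` in detailed
balance, continued by a constant beyond `N`. The formula gives `0 / 0 = 0` at `0`, where
the value is immaterial. -/
noncomputable def steinSolution (N : ℕ) (p : ℝ) (w f : ℕ → ℝ) (m : ℕ) : ℝ :=
  if m ≤ N then
    (∑ i ∈ range m, w i * (f i - ∑ j ∈ range (N + 1), w j * f j)) / (m * (1 - p) * w m)
  else (∑ j ∈ range (N + 1), w j * f j) / ((1 - p) * (N + 1))

lemma abs_steinSolution_sub_le_of_lt (hαN : N ≤ α) (hp : 0 < p) (hp1 : p < 1)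
    (hw : ∀ m ≤ N, 0 < w m)
    (hbal : ∀ m < N, (m + 1) * (1 - p) * w (m + 1) = (α - m) * p * w m)
    (hsum : ∑ m ∈ range (N + 1), w m = 1) {f : ℕ → ℝ} (hf : ∀ m, 0 ≤ f m ∧ f m ≤ 1)
    {j : ℕ} (hj1 : 1 ≤ j) (hj : j < N) :
    |steinSolution N p w f (j + 1) - steinSolution N p w f j| ≤ 1 / ((α + 1) * p * (1 - p)) := by
  have hjN : (j : ℝ) < N := by exact_mod_cast hj
  have hj0 : (0 : ℝ) < j := by exact_mod_cast hj1
  have hwj := hw j hj.le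
  have hq : 0 < 1 - p := by linarith
  have split : ∀ v : ℕ → ℝ, ∑ i ∈ range (N + 1), v i
      = ∑ i ∈ range j, v i + ∑ i ∈ Ico (j + 1) (N + 1), v i + v j := by
    intro v
    rw [← sum_range_add_sum_Ico v (show j ≤ N + 1 by omega),
      sum_eq_sum_Ico_succ_bot (show j < N + 1 by omega)]
    ring
  have hone := split w
  rw [hsum] at hone
  have he := split fun i => w i * f i
  have h1 := upper_tail_le hαN hp hp1 hw hbal hj
  have h2 := lower_tail_le hp hp1 hw hbal hj.le
  rw [sum_eq_sum_Ico_succ_bot (show j < N + 1 by omega)] at h1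
  rw [sum_range_succ] at h2
  have hG : ∀ e, ∑ i ∈ range j, w i * (f i - e)
      = ∑ i ∈ range j, w i * f i - e * ∑ i ∈ range j, w i := by
    intro e; rw [mul_sum, ← sum_sub_distrib]; exact sum_congr rfl fun i _ => by ring
  have wf : ∀ i ≤ N, 0 ≤ w i * f i ∧ w i * f i ≤ w i := fun i hi =>
    ⟨mul_nonneg (hw i hi).le (hf i).1, mul_le_of_le_one_right (hw i hi).le (hf i).2⟩
  have key := abs_increment_le (F := ∑ i ∈ range j, w i) (U := ∑ i ∈ Ico (j + 1) (N + 1), w i)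
    (w := w j) (A := ∑ i ∈ range j, w i * f i) (B := ∑ i ∈ Ico (j + 1) (N + 1), w i * f i)
    (f := f j) (b := (α - j) * p) (d := j * (1 - p)) (p := p) (α := α) hp hp1
    (sum_nonneg fun i hi => (hw i (by have := mem_range.1 hi; omega)).le)
    (sum_nonneg fun i hi => (hw i (by have := mem_Ico.1 hi; omega)).le) hwj.le
    (sum_nonneg fun i hi => (wf i (by have := mem_range.1 hi; omega)).1)
    (sum_le_sum fun i hi => (wf i (by have := mem_range.1 hi; omega)).2)
    (sum_nonneg fun i hi => (wf i (by have := mem_Ico.1 hi; omega)).1)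
    (sum_le_sum fun i hi => (wf i (by have := mem_Ico.1 hi; omega)).2)
    (hf j).1 (hf j).2 hone.symm (mul_pos (by linarith) hp) (mul_pos hj0 hq) (by linarith)
    (by ring) (h1.trans_eq (by rw [hone]; ring)) (h2.trans_eq (by rw [hone]; ring))
  rw [← he] at key
  rw [steinSolution, steinSolution, if_pos (by omega), if_pos hj.le, sum_range_succ, hG]
  set e := ∑ i ∈ range (N + 1), w i * f i
  set A := ∑ i ∈ range j, w i * f i
  set B := ∑ i ∈ Ico (j + 1) (N + 1), w i * f i
  set F := ∑ i ∈ range j, w i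
  set U := ∑ i ∈ Ico (j + 1) (N + 1), w i
  have hb := hbal j hj
  push_cast
  rw [hb]
  have hG1 : A - e * F + w j * (f j - e) = e * U - B := by
    have : F = 1 - U - w j := by linarith
    rw [this]; linarith
  have hb0 : (α - j) * p ≠ 0 := (mul_pos (by linarith) hp).ne'
  have e1 : (e * U - B) / ((α - j) * p * w j) - (A - e * F) / (j * (1 - p) * w j)
      = ((e * U - B) / ((α - j) * p) - (A - e * F) / (j * (1 - p))) / w j := by
    rw [sub_div _ _ (w j), div_div, div_div]
  rw [hG1, e1, abs_div, abs_of_pos hwj, div_le_iff₀ hwj, mul_comm _ (w j)]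
  exact key

lemma sum_mul_sub_eq (hsum : ∑ m ∈ range (N + 1), w m = 1) (f : ℕ → ℝ) :
    ∑ i ∈ range N, w i * (f i - ∑ j ∈ range (N + 1), w j * f j)
      = w N * (∑ j ∈ range (N + 1), w j * f j - f N) := by
  set e := ∑ j ∈ range (N + 1), w j * f j with he
  have h : ∑ i ∈ range (N + 1), w i * (f i - e) = 0 := by
    simp only [mul_sub, sum_sub_distrib, ← sum_mul, hsum, ← he]; ring
  rw [sum_range_succ] at h
  linarith

lemma steinSolution_last (hN : 1 ≤ N) (hp1 : p < 1) (hw : ∀ m ≤ N, 0 < w m)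
    (hsum : ∑ m ∈ range (N + 1), w m = 1) (f : ℕ → ℝ) :
    steinSolution N p w f N = (∑ j ∈ range (N + 1), w j * f j - f N) / (N * (1 - p)) := by
  have hN0 : (N : ℝ) ≠ 0 := by exact_mod_cast (by omega : N ≠ 0)
  have hq : 1 - p ≠ 0 := by linarith
  have := (hw N le_rfl).ne'
  rw [steinSolution, if_pos le_rfl, sum_mul_sub_eq hsum]
  field_simp

lemma abs_steinSolution_sub_le_of_eq (hN : 1 ≤ N) (hαN : N ≤ α) (hαN' : α ≤ N + 1) (hp : 0 < p)
    (hp2 : p ≤ 1 / 2) (hw : ∀ m ≤ N, 0 < w m)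
    (hbal : ∀ m < N, (m + 1) * (1 - p) * w (m + 1) = (α - m) * p * w m)
    (hsum : ∑ m ∈ range (N + 1), w m = 1) {f : ℕ → ℝ} (hf : ∀ m, f m = 0 ∨ f m = 1) :
    |steinSolution N p w f (N + 1) - steinSolution N p w f N| ≤ 1 / ((α + 1) * p * (1 - p)) := by
  have hN1 : (1 : ℝ) ≤ N := by exact_mod_cast hN
  have hq : 0 < 1 - p := by linarith
  rw [steinSolution_last hN (by linarith) hw hsum, steinSolution, if_neg (by omega)]
  have hf01 : ∀ m, 0 ≤ f m ∧ f m ≤ 1 := fun m => by rcases hf m with h | h <;> rw [h] <;> norm_num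
  have he1 : ∑ j ∈ range (N + 1), w j * f j ≤ 1 := by
    rw [← hsum]
    exact sum_le_sum fun i hi => mul_le_of_le_one_right
      (hw i (by have := mem_range.1 hi; omega)).le (hf01 i).2
  have heN : w N * f N ≤ ∑ j ∈ range (N + 1), w j * f j :=
    single_le_sum (f := fun j => w j * f j) (fun i hi =>
      mul_nonneg (hw i (by have := mem_range.1 hi; omega)).le (hf01 i).1) (by simp)
  have he0 : 0 ≤ ∑ j ∈ range (N + 1), w j * f j :=
    (mul_nonneg (hw N le_rfl).le (hf01 N).1).trans heN
  set e := ∑ j ∈ range (N + 1), w j * f j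
  have hα1 : 0 < (α + 1) * p := mul_pos (by linarith) hp
  have eq : e / ((1 - p) * (N + 1)) - (e - f N) / (N * (1 - p))
      = ((N + 1) * f N - e) / (N * (N + 1)) / (1 - p) := by
    field_simp; ring
  have hNN : (0 : ℝ) < N * (N + 1) := by positivity
  rw [eq, abs_div, abs_of_pos hq, ← div_div 1, div_le_div_iff_of_pos_right hq, abs_div,
    abs_of_pos hNN, div_le_div_iff₀ hNN hα1, one_mul]
  have hαp : (α + 1) * p ≤ (N + 2) * (1 / 2) :=
    mul_le_mul (by linarith) hp2 hp.le (by linarith)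
  rcases hf N with h | h
  · rw [h, mul_zero, zero_sub, abs_neg, abs_of_nonneg he0]
    have : e * ((α + 1) * p) ≤ 1 * ((α + 1) * p) := mul_le_mul_of_nonneg_right he1 hα1.le
    nlinarith
  · rw [h, mul_one, abs_of_nonneg (by linarith)]
    rw [h, mul_one] at heN
    rcases hN.eq_or_lt with h1 | h1
    · -- For `N = 1` the bound `e ≥ w 1 = α p / (1 - p + α p)` is needed.
      subst h1
      have hb := hbal 0 one_pos
      simp only [sum_range_succ, range_zero, sum_empty, zero_add] at hsum
      norm_num at hb hαN hαN' ⊢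
      have hw0 : w 0 = 1 - w 1 := by linarith
      rw [hw0] at hb
      have hpos : 0 < 1 - p + α * p := by nlinarith
      have h3 : α * p ≤ e * (1 - p + α * p) := by nlinarith
      have h4 : (2 - e) * ((α + 1) * p) * (1 - p + α * p) ≤ 2 * (1 - p + α * p) := by
        have h5 : (2 - e) * (1 - p + α * p) ≤ 2 - 2 * p + α * p := by linarith
        have h6 := mul_le_mul_of_nonneg_right h5 hα1.le
        have h7 : 0 ≤ (2 - α) * (α + 1) * p ^ 2 :=
          mul_nonneg (mul_nonneg (by linarith) (by linarith)) (sq_nonneg p)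
        nlinarith
      have := le_of_mul_le_mul_right h4 hpos
      linarith
    · have hN2 : (2 : ℝ) ≤ N := by exact_mod_cast h1
      have : (N + 1 - e) * ((α + 1) * p) ≤ (N + 1) * ((α + 1) * p) :=
        mul_le_mul_of_nonneg_right (by linarith) hα1.le
      nlinarith

lemma abs_steinSolution_sub_le (hN : 1 ≤ N) (hαN : N ≤ α) (hαN' : α ≤ N + 1) (hp : 0 < p)
    (hp2 : p ≤ 1 / 2) (hw : ∀ m ≤ N, 0 < w m)
    (hbal : ∀ m < N, (m + 1) * (1 - p) * w (m + 1) = (α - m) * p * w m)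
    (hsum : ∑ m ∈ range (N + 1), w m = 1) {f : ℕ → ℝ} (hf : ∀ m, f m = 0 ∨ f m = 1)
    {j : ℕ} (hj : 1 ≤ j) :
    |steinSolution N p w f (j + 1) - steinSolution N p w f j| ≤ 1 / ((α + 1) * p * (1 - p)) := by
  rcases lt_trichotomy j N with h | rfl | h
  · exact abs_steinSolution_sub_le_of_lt hαN hp (by linarith) hw hbal hsum
      (fun m => by rcases hf m with h | h <;> rw [h] <;> norm_num) hj h
  · exact abs_steinSolution_sub_le_of_eq hj hαN hαN' hp hp2 hw hbal hsum hf
  · rw [steinSolution, steinSolution, if_neg (by omega), if_neg (by omega), sub_self, abs_zero]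
    have : (0 : ℝ) ≤ N := by positivity
    exact div_nonneg zero_le_one (mul_nonneg (mul_nonneg (by linarith) hp.le) (by linarith))

/-- The Stein equation as an inequality valid at every natural number, also beyond the support of the
weights. The only error is at `m = N`. -/
lemma sub_le_steinSolution (hN : 1 ≤ N) (hαN : N ≤ α) (hαN' : α ≤ N + 1) (hp : 0 < p)
    (hp1 : p < 1) (hw : ∀ m ≤ N, 0 < w m)
    (hbal : ∀ m < N, (m + 1) * (1 - p) * w (m + 1) = (α - m) * p * w m)
    (hsum : ∑ m ∈ range (N + 1), w m = 1) {f : ℕ → ℝ} (hf : ∀ m, 0 ≤ f m ∧ f m ≤ 1)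
    (m : ℕ) :
    ∑ i ∈ range (N + 1), w i * f i - f m ≤
      -(α * p * steinSolution N p w f (m + 1) - m * (steinSolution N p w f m
          + p * (steinSolution N p w f (m + 1) - steinSolution N p w f m)))
        + (α - N) * p / ((1 - p) * (N + 1)) * (if m = N then 1 else 0) := by
  have hN1 : (1 : ℝ) ≤ N := by exact_mod_cast hN
  have hq : 0 < 1 - p := by linarith
  have he1 : ∑ j ∈ range (N + 1), w j * f j ≤ 1 := by
    rw [← hsum]
    exact sum_le_sum fun i hi => mul_le_of_le_one_right
      (hw i (by have := mem_range.1 hi; omega)).le (hf i).2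
  have he0 : 0 ≤ ∑ j ∈ range (N + 1), w j * f j :=
    sum_nonneg fun i hi => mul_nonneg (hw i (by have := mem_range.1 hi; omega)).le (hf i).1
  have hop : ∀ x y : ℝ, α * p * x - m * (y + p * (x - y)) = (α - m) * p * x - m * (1 - p) * y := by
    intro x y; ring
  rw [hop]
  rcases lt_trichotomy m N with h | rfl | h
  · have hmN : (m : ℝ) < N := by exact_mod_cast h
    have hwm := (hw m h.le).ne'
    have hb0 : (α - m) * p ≠ 0 := (mul_pos (by linarith) hp).ne'
    rw [if_neg h.ne, mul_zero, add_zero, steinSolution, steinSolution, if_pos (by omega),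
      if_pos h.le, sum_range_succ _ m]
    push_cast
    rw [hbal m h]
    set e := ∑ j ∈ range (N + 1), w j * f j
    have e2 : m * (1 - p) * ((∑ i ∈ range m, w i * (f i - e)) / (m * (1 - p) * w m))
        = (∑ i ∈ range m, w i * (f i - e)) / w m := by
      rcases Nat.eq_zero_or_pos m with rfl | h0
      · simp
      · have : (m : ℝ) ≠ 0 := by exact_mod_cast h0.ne'
        field_simp
    rw [e2]
    have e1 : ∀ S : ℝ, (α - m) * p * (S / ((α - m) * p * w m)) = S / w m := by
      intro S
      rw [← div_div, mul_comm, div_mul_eq_mul_div, div_mul_cancel₀ _ hb0]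
    rw [e1, add_div, mul_div_cancel_left₀ _ hwm]
    linarith
  · rw [if_pos rfl, steinSolution_last hN hp1 hw hsum, steinSolution, if_neg (by omega), mul_one]
    set e := ∑ j ∈ range (m + 1), w j * f j
    have hm0 : (m : ℝ) * (1 - p) ≠ 0 := by positivity
    rw [mul_div_cancel₀ _ hm0]
    have : (α - m) * p * (e / ((1 - p) * (m + 1))) ≤ (α - m) * p / ((1 - p) * (m + 1)) := by
      rw [← mul_div_assoc]
      refine div_le_div_of_nonneg_right (mul_le_of_le_one_right
        (mul_nonneg (by linarith) hp.le) he1) (by positivity)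
    linarith
  · have hmN : (N : ℝ) + 1 ≤ m := by exact_mod_cast h
    rw [if_neg h.ne', mul_zero, add_zero, steinSolution, steinSolution, if_neg (by omega),
      if_neg (by omega)]
    set e := ∑ j ∈ range (N + 1), w j * f j
    have h1 : e = (1 - p) * (N + 1) * (e / ((1 - p) * (N + 1))) := by field_simp
    have h2 : 0 ≤ e / ((1 - p) * (N + 1)) := by positivity
    have h3 : (1 - p) * (N + 1) ≤ m - α * p := by nlinarith
    have h4 := mul_le_mul_of_nonneg_right h3 h2
    have := (hf m).1
    linarith

end

end

/-! ### The law of the run count -/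

section
open Finset Polynomial

section
variable {Ω : Type*} {k₁ k₂ : ℕ} {ξ : ℕ → Ω → ℕ}

lemma runIndicator_eq_ite (hξ : ∀ l ω, ξ l ω ≤ 1) (l : ℕ) (ω : Ω) :
    runIndicator k₁ k₂ ξ l ω =
      if ∀ i ∈ Ico l (l + (k₁ + k₂)), ξ i ω = if i < l + k₁ then 0 else 1 then 1 else 0 := by
  have h01 : ∀ i, ξ i ω = 0 ∨ ξ i ω = 1 := fun i => by have := hξ i ω; omega
  split_ifs with h
  · have e1 : ∏ j ∈ range k₁, (1 - ξ (l + j) ω) = 1 := by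
      refine prod_eq_one fun j hj => ?_
      have := mem_range.1 hj
      have h' := h (l + j) (mem_Ico.2 (by omega))
      rw [if_pos (by omega)] at h'
      omega
    have e2 : ∏ j ∈ range k₂, ξ (l + k₁ + j) ω = 1 := by
      refine prod_eq_one fun j hj => ?_
      have := mem_range.1 hj
      have h' := h (l + k₁ + j) (mem_Ico.2 (by omega))
      rwa [if_neg (by omega)] at h'
    rw [runIndicator, e1, e2]
  · push Not at h
    obtain ⟨i, hi, hne⟩ := h
    obtain ⟨hi1, hi2⟩ := mem_Ico.1 hi
    rw [runIndicator]
    rcases lt_or_ge i (l + k₁) with hlt | hge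
    · rw [if_pos hlt] at hne
      rw [prod_eq_zero (i := i - l) (mem_range.2 (by omega)), zero_mul]
      rw [show l + (i - l) = i by omega]
      have := h01 i
      omega
    · rw [if_neg (by omega)] at hne
      rw [mul_comm, prod_eq_zero (i := i - (l + k₁)) (mem_range.2 (by omega)), zero_mul]
      rw [show l + k₁ + (i - (l + k₁)) = i by omega]
      have := h01 i
      omega

lemma runIndicator_le_one (hξ : ∀ l ω, ξ l ω ≤ 1) (l : ℕ) (ω : Ω) :
    runIndicator k₁ k₂ ξ l ω ≤ 1 := by
  rw [runIndicator_eq_ite hξ]; split_ifs <;> omega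

/-- Two runs whose windows of `k₁ + k₂` trials meet cannot both occur. -/
lemma runIndicator_eq_zero_of_overlap (hk₁ : 1 ≤ k₁) (hk₂ : 1 ≤ k₂) (hξ : ∀ l ω, ξ l ω ≤ 1)
    {l l' : ℕ} {ω : Ω} (h1 : l < l') (h2 : l' < l + (k₁ + k₂))
    (h : runIndicator k₁ k₂ ξ l' ω ≠ 0) : runIndicator k₁ k₂ ξ l ω = 0 := by
  rw [runIndicator_eq_ite hξ] at h ⊢
  refine if_neg fun hl => ?_
  have hl' : ∀ i ∈ Ico l' (l' + (k₁ + k₂)), ξ i ω = if i < l' + k₁ then 0 else 1 := by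
    by_contra hc; exact h (if_neg hc)
  -- At this position the earlier run has a success and the later one a failure.
  have e1 := hl (max (l + k₁) l') (mem_Ico.2 (by omega))
  have e2 := hl' (max (l + k₁) l') (mem_Ico.2 (by omega))
  rw [if_neg (by omega)] at e1
  rw [if_pos (by omega)] at e2
  omega

lemma runCount_le (hξ : ∀ l ω, ξ l ω ≤ 1) (m : ℕ) (ω : Ω) : runCount m k₁ k₂ ξ ω ≤ m + 1 := by
  refine (sum_le_card_nsmul _ _ 1 fun l _ => runIndicator_le_one hξ l ω).trans ?_
  simp

lemma runCount_of_lt {m : ℕ} (h : m < k₁ + k₂) (ω : Ω) : runCount m k₁ k₂ ξ ω = 0 := by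
  rw [runCount, Icc_eq_empty (by omega), sum_empty]

/-- The last possible run contributes an increment of `h` that depends only on the trials before its
window, because no earlier run overlaps a run that occurs. -/
lemma comp_runCount_eq (hk₁ : 1 ≤ k₁) (hk₂ : 1 ≤ k₂) (hξ : ∀ l ω, ξ l ω ≤ 1) {m : ℕ}
    (hm : k₁ + k₂ ≤ m) (h : ℕ → ℝ) (ω : Ω) :
    h (runCount m k₁ k₂ ξ ω) = h (runCount (m - 1) k₁ k₂ ξ ω) +
      runIndicator k₁ k₂ ξ (m + 1 - (k₁ + k₂)) ω *
        forwardDiff h (runCount (m - (k₁ + k₂)) k₁ k₂ ξ ω) := by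
  have hsucc : runCount m k₁ k₂ ξ ω = runCount (m - 1) k₁ k₂ ξ ω +
      runIndicator k₁ k₂ ξ (m + 1 - (k₁ + k₂)) ω := by
    rw [runCount, runCount, show m + 1 - (k₁ + k₂) = m - 1 + 1 - (k₁ + k₂) + 1 by omega,
      sum_Icc_succ_top (by omega)]
  rcases Nat.eq_zero_or_pos (runIndicator k₁ k₂ ξ (m + 1 - (k₁ + k₂)) ω) with h0 | hpos
  · rw [hsucc, h0]; simp
  · have h1 : runIndicator k₁ k₂ ξ (m + 1 - (k₁ + k₂)) ω = 1 :=
      le_antisymm (runIndicator_le_one hξ _ ω) hpos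
    have hsame : runCount (m - 1) k₁ k₂ ξ ω = runCount (m - (k₁ + k₂)) k₁ k₂ ξ ω := by
      symm
      refine sum_subset (Icc_subset_Icc le_rfl (by omega)) fun l hl hl' => ?_
      rw [mem_Icc] at hl hl'
      exact runIndicator_eq_zero_of_overlap hk₁ hk₂ hξ (by omega) (by omega) hpos.ne'
    rw [hsucc, h1, hsame]
    simp [forwardDiff]

lemma runIndicator_congr {Ω' : Type*} {ξ' : ℕ → Ω' → ℕ} {l : ℕ} {ω : Ω} {ω' : Ω'}
    (h : ∀ i ∈ Ico l (l + (k₁ + k₂)), ξ i ω = ξ' i ω') :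
    runIndicator k₁ k₂ ξ l ω = runIndicator k₁ k₂ ξ' l ω' := by
  rw [runIndicator, runIndicator]
  congr 1
  · refine prod_congr rfl fun j hj => ?_
    have := mem_range.1 hj
    rw [h _ (mem_Ico.2 (by omega))]
  · refine prod_congr rfl fun j hj => ?_
    have := mem_range.1 hj
    rw [h _ (mem_Ico.2 (by omega))]

lemma runCount_congr {Ω' : Type*} {ξ' : ℕ → Ω' → ℕ} {m : ℕ} {ω : Ω} {ω' : Ω'}
    (h : ∀ i ∈ Icc 1 m, ξ i ω = ξ' i ω') :
    runCount m k₁ k₂ ξ ω = runCount m k₁ k₂ ξ' ω' := by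
  refine sum_congr rfl fun l hl => runIndicator_congr fun i hi => h i ?_
  rw [mem_Icc] at hl ⊢
  rw [mem_Ico] at hi
  omega

variable [MeasurableSpace Ω]

lemma measurable_runIndicator (hm : ∀ l, Measurable (ξ l)) (l : ℕ) :
    Measurable (runIndicator k₁ k₂ ξ l) := by
  unfold runIndicator
  exact (Finset.measurable_fun_prod _ fun j _ => (measurable_from_top (f := fun x : ℕ => 1 - x)).comp
    (hm _)).mul (Finset.measurable_fun_prod _ fun j _ => hm _)

lemma measurable_runCount (hm : ∀ l, Measurable (ξ l)) (m : ℕ) :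
    Measurable (runCount m k₁ k₂ ξ) := by
  unfold runCount
  exact Finset.measurable_fun_sum _ fun l _ => measurable_runIndicator hm l

variable {μ : Measure Ω} {n : ℕ}

lemma integrable_comp_runCount [IsProbabilityMeasure μ] (hm : ∀ l, Measurable (ξ l)) (hξ : ∀ l ω, ξ l ω ≤ 1) (m : ℕ)
    (h : ℕ → ℝ) : Integrable (fun ω => h (runCount m k₁ k₂ ξ ω)) μ := by
  refine Integrable.of_bound
    ((measurable_from_top (f := h)).comp (measurable_runCount hm m)).aestronglyMeasurable
    (∑ j ∈ range (m + 2), |h j|) (ae_of_all _ fun ω => ?_)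
  exact single_le_sum (f := fun j => |h j|) (fun _ _ => abs_nonneg _)
    (mem_range.2 (by have := runCount_le (k₁ := k₁) (k₂ := k₂) hξ m ω; omega))

lemma integral_runIndicator (hm : ∀ l, Measurable (ξ l)) (hξ : ∀ l ω, ξ l ω ≤ 1)
    (hindep : iIndepFun (fun l : Icc 1 n => ξ l) μ) {p : ℝ}
    (hone : ∀ l ∈ Icc 1 n, μ.real (ξ l ⁻¹' {1}) = p)
    (hzero : ∀ l ∈ Icc 1 n, μ.real (ξ l ⁻¹' {0}) = 1 - p) {l : ℕ} (hl : 1 ≤ l)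
    (hln : l + (k₁ + k₂) ≤ n + 1) :
    ∫ ω, (runIndicator k₁ k₂ ξ l ω : ℝ) ∂μ = runProb k₁ k₂ p := by
  set c : ℕ → ℕ := fun i => if i < l + k₁ then 0 else 1 with hc
  have hmem : ∀ i ∈ Ico l (l + (k₁ + k₂)), i ∈ Icc 1 n := fun i hi => by
    rw [mem_Ico] at hi; rw [mem_Icc]; omega
  set S : Finset (Icc 1 n) := (Ico l (l + (k₁ + k₂))).subtype (· ∈ Icc 1 n) with hS
  have hset : ∀ ω, (runIndicator k₁ k₂ ξ l ω : ℝ)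
      = (⋂ i ∈ S, ξ i ⁻¹' {c i}).indicator 1 ω := by
    intro ω
    classical
    rw [runIndicator_eq_ite hξ, Set.indicator_apply]
    have : (∀ i ∈ Ico l (l + (k₁ + k₂)), ξ i ω = if i < l + k₁ then 0 else 1) ↔
        ω ∈ ⋂ i ∈ S, ξ i ⁻¹' {c i} := by
      simp only [Set.mem_iInter, hS, mem_subtype, Set.mem_preimage, Set.mem_singleton_iff, hc]
      exact ⟨fun h i hi => h i hi, fun h i hi => h ⟨i, hmem i hi⟩ hi⟩
    by_cases h : ω ∈ ⋂ i ∈ S, ξ i ⁻¹' {c i}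
    · rw [if_pos (this.2 h), if_pos h]; simp
    · rw [if_neg (fun h' => h (this.1 h')), if_neg h]; simp
  have hms : MeasurableSet (⋂ i ∈ S, ξ (i : ℕ) ⁻¹' {c i}) :=
    S.measurableSet_biInter fun i _ => hm _ (measurableSet_singleton _)
  simp_rw [hset]
  rw [integral_indicator_one hms, measureReal_def,
    hindep.measure_inter_preimage_eq_mul S (sets := fun i => {c i})
      (fun i _ => measurableSet_singleton _), ENNReal.toReal_prod]
  have e : ∀ i ∈ Ico l (l + (k₁ + k₂)), (μ (ξ i ⁻¹' {c i})).toReal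
      = if i < l + k₁ then 1 - p else p := by
    intro i hi
    simp only [hc]
    split_ifs
    · exact hzero i (hmem i hi)
    · exact hone i (hmem i hi)
  rw [hS, prod_subtype_of_mem (fun i => (μ (ξ i ⁻¹' {c i})).toReal) hmem, prod_congr rfl e,
    prod_Ico_eq_prod_range, Nat.add_sub_cancel_left, prod_range_add]
  rw [prod_congr rfl (g := fun _ => 1 - p) fun j hj => if_pos (by have := mem_range.1 hj; omega),
    prod_congr rfl (g := fun _ => p) fun j hj => if_neg (by omega)]
  simp [runProb]

lemma indepFun_runIndicator_runCount (hm : ∀ l, Measurable (ξ l))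
    (hindep : iIndepFun (fun l : Icc 1 n => ξ l) μ) {l m : ℕ} (hml : m < l)
    (hln : l + (k₁ + k₂) ≤ n + 1) :
    IndepFun (runIndicator k₁ k₂ ξ l) (runCount m k₁ k₂ ξ) μ := by
  set S : Finset (Icc 1 n) := (Ico l (l + (k₁ + k₂))).subtype (· ∈ Icc 1 n) with hS
  set T : Finset (Icc 1 n) := (Icc 1 m).subtype (· ∈ Icc 1 n) with hT
  have hST : Disjoint S T := by
    rw [Finset.disjoint_left]
    intro i hi hi'
    rw [hS, mem_subtype, mem_Ico] at hi
    rw [hT, mem_subtype, mem_Icc] at hi'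
    omega
  have hI := hindep.indepFun_finset S T hST fun i => hm i
  -- A tuple of trials with indices in `R`, extended by zero.
  let ext (R : Finset (Icc 1 n)) (i : ℕ) (y : R → ℕ) : ℕ :=
    if h : ∃ hi : i ∈ Icc 1 n, ⟨i, hi⟩ ∈ R then y ⟨⟨i, h.1⟩, h.2⟩ else 0
  have hext : ∀ R i, Measurable (ext R i) := by
    intro R i
    by_cases h : ∃ hi : i ∈ Icc 1 n, ⟨i, hi⟩ ∈ R
    · simp only [ext, dif_pos h]; exact measurable_pi_apply _
    · simp only [ext, dif_neg h]; exact measurable_const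
  have h1 : runIndicator k₁ k₂ ξ l
      = runIndicator k₁ k₂ (ext S) l ∘ fun ω (i : S) => ξ i ω := by
    funext ω
    refine runIndicator_congr fun i hi => ?_
    have hi' := mem_Ico.1 hi
    have hin : i ∈ Icc 1 n := mem_Icc.2 (by omega)
    have : ∃ hi : i ∈ Icc 1 n, ⟨i, hi⟩ ∈ S := ⟨hin, mem_subtype.2 hi⟩
    simp only [ext, dif_pos this]
  have h2 : runCount m k₁ k₂ ξ = runCount m k₁ k₂ (ext T) ∘ fun ω (i : T) => ξ i ω := by
    funext ω
    refine runCount_congr fun i hi => ?_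
    have hi' := mem_Icc.1 hi
    have hin : i ∈ Icc 1 n := mem_Icc.2 (by omega)
    have : ∃ hi : i ∈ Icc 1 n, ⟨i, hi⟩ ∈ T := ⟨hin, mem_subtype.2 hi⟩
    simp only [ext, dif_pos this]
  rw [h1, h2]
  exact hI.comp (measurable_runIndicator (hext S) l) (measurable_runCount (hext T) m)

/-- The law of the run count: `E h(Bₘ) = (φₘ(a Δ) h)(0)`. -/
lemma integral_comp_runCount_eq_aeval [IsProbabilityMeasure μ] (hk₁ : 1 ≤ k₁) (hk₂ : 1 ≤ k₂) (hm : ∀ l, Measurable (ξ l))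
    (hξ : ∀ l ω, ξ l ω ≤ 1) (hindep : iIndepFun (fun l : Icc 1 n => ξ l) μ) {p : ℝ}
    (hone : ∀ l ∈ Icc 1 n, μ.real (ξ l ⁻¹' {1}) = p)
    (hzero : ∀ l ∈ Icc 1 n, μ.real (ξ l ⁻¹' {0}) = 1 - p) {m : ℕ} (hmn : m ≤ n) (h : ℕ → ℝ) :
    ∫ ω, h (runCount m k₁ k₂ ξ ω) ∂μ =
      aeval (R := ℝ) (A := Module.End ℝ (ℕ → ℝ)) (runProb k₁ k₂ p • forwardDiff)
        (runPoly (k₁ + k₂) m) h 0 := by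
  induction m using Nat.strong_induction_on generalizing h with
  | _ m ih =>
    rcases lt_or_ge m (k₁ + k₂) with hmk | hmk
    · simp [runPoly_of_lt hmk, runCount_of_lt hmk]
    · have hind : IndepFun (runIndicator k₁ k₂ ξ (m + 1 - (k₁ + k₂)))
          (runCount (m - (k₁ + k₂)) k₁ k₂ ξ) μ :=
        indepFun_runIndicator_runCount hm hindep (by omega) (by omega)
      have hmul := (hind.comp (φ := fun x : ℕ => (x : ℝ)) (ψ := forwardDiff h)
        measurable_from_top measurable_from_top).integral_fun_mul_eq_mul_integral
        (measurable_from_top.comp (measurable_runIndicator hm _)).aestronglyMeasurable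
        (measurable_from_top.comp (measurable_runCount hm _)).aestronglyMeasurable
      simp only [Function.comp_apply] at hmul
      simp_rw [comp_runCount_eq hk₁ hk₂ hξ hmk h]
      rw [integral_add (integrable_comp_runCount hm hξ _ _) ?_, hmul,
        integral_runIndicator hm hξ hindep hone hzero (by omega) (by omega),
        ih (m - 1) (by omega) (by omega), ih (m - (k₁ + k₂)) (by omega) (by omega),
        runPoly_of_le (by omega) hmk, mul_comm X]
      · simp [Module.End.mul_apply]
      · refine ((integrable_comp_runCount (k₁ := k₁) (k₂ := k₂) (μ := μ) hm hξ (m - (k₁ + k₂))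
          (forwardDiff h)).bdd_mul (c := 1)
          (measurable_from_top.comp (measurable_runIndicator hm _)).aestronglyMeasurable
          (ae_of_all _ fun ω => ?_))
        have := runIndicator_le_one (k₁ := k₁) (k₂ := k₂) hξ (m + 1 - (k₁ + k₂)) ω
        simpa using this
end

end

/-! ### Estimates for the constants, and the pseudo-binomial law -/

section
open Finset

/-- The binomial series for `(1 + x) ^ j` cut after the cubic term. -/
lemma cubic_le_one_add_pow {x : ℝ} (hx : 0 ≤ x) (j : ℕ) :
    1 + j * x + j * (j - 1) / 2 * x ^ 2 + j * (j - 1) * (j - 2) / 6 * x ^ 3 ≤ (1 + x) ^ j := by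
  induction j with
  | zero => simp
  | succ j ih =>
    have h1 := mul_le_mul_of_nonneg_right ih (show 0 ≤ 1 + x by linarith)
    have h2 : (0 : ℝ) ≤ j * (j - 1) * (j - 2) := by
      rcases j with _ | _ | j
      · simp
      · simp
      · push_cast
        have : (0 : ℝ) ≤ j := by positivity
        have e : ((j : ℝ) + 1 + 1) * (j + 1 + 1 - 1) * (j + 1 + 1 - 2) = (j + 2) * (j + 1) * j := by
          ring
        rw [e]; positivity
    have h3 := mul_nonneg h2 (pow_nonneg hx 4)
    rw [pow_succ (1 + x)]
    push_cast
    nlinarith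

lemma kStar_succ {j : ℕ} (hj : 1 ≤ j) : kStar (j + 1) = (1 + 1 / j) ^ j := by
  have : (j : ℝ) ≠ 0 := by exact_mod_cast (by omega : j ≠ 0)
  rw [kStar, Nat.add_sub_cancel]
  push_cast
  rw [add_sub_cancel_right, add_div, div_self this]

lemma two_le_kStar {k : ℕ} (hk : 2 ≤ k) : 2 ≤ kStar k := by
  obtain ⟨j, rfl⟩ : ∃ j, k = j + 1 := ⟨k - 1, by omega⟩
  have : (j : ℝ) ≠ 0 := by exact_mod_cast (by omega : j ≠ 0)
  rw [kStar_succ (by omega)]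
  have h := one_add_mul_le_pow (show (-2 : ℝ) ≤ 1 / j by
    have : (0 : ℝ) ≤ 1 / j := by positivity
    linarith) j
  rw [mul_one_div_cancel this] at h
  linarith

/-- Equality holds at `k = 2`; the Bernoulli inequality would be too weak for large `k`. -/
lemma two_mul_sub_one_le {k : ℕ} (hk : 2 ≤ k) : 2 * (k : ℝ) - 1 ≤ 3 / 4 * (k * kStar k) := by
  obtain ⟨j, rfl⟩ : ∃ j, k = j + 1 := ⟨k - 1, by omega⟩
  have hj : (0 : ℝ) < j := by exact_mod_cast (by omega : 0 < j)
  rw [kStar_succ (by omega)]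
  have h := cubic_le_one_add_pow (show (0 : ℝ) ≤ 1 / j by positivity) j
  have e : 1 + j * (1 / j : ℝ) + j * (j - 1) / 2 * (1 / j) ^ 2
      + j * (j - 1) * (j - 2) / 6 * (1 / j) ^ 3 = (8 * j ^ 2 - 3 * j + 1) / (3 * j ^ 2) := by
    field_simp; ring
  rw [e, div_le_iff₀ (by positivity)] at h
  push_cast
  have h1 : (8 * (j : ℝ) ^ 2 - 3 * j + 1) * (j + 1) ≤ (1 + 1 / j) ^ j * (3 * j ^ 2) * (j + 1) :=
    mul_le_mul_of_nonneg_right h (by positivity)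
  have hj2 : (0 : ℝ) < j ^ 2 := by positivity
  refine le_of_mul_le_mul_right ?_ hj2
  -- After clearing denominators the difference of the two sides is a multiple of `(j - 1) ^ 2`.
  nlinarith [sq_nonneg ((j : ℝ) - 1)]

section pseudoBinomial
variable {α p : ℝ}

lemma succ_mul_choose (α : ℝ) (m : ℕ) :
    ((m : ℝ) + 1) * Ring.choose α (m + 1) = (α - m) * Ring.choose α m := by
  have h := Ring.choose_smul_choose α (Nat.le_succ m)
  rw [Nat.succ_eq_add_one, Nat.choose_succ_self_right, Nat.add_sub_cancel_left,
    Ring.choose_one_right, nsmul_eq_mul] at h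
  push_cast at h
  rw [h, mul_comm]

/-- Detailed balance of the pseudo-binomial weights. -/
lemma pbWeight_succ (hp1 : p < 1) (m : ℕ) :
    (m + 1) * (1 - p) * pbWeight α p (m + 1) = (α - m) * p * pbWeight α p m := by
  have hq : 0 < 1 - p := by linarith
  have h1 : (1 - p) ^ (α - m) = (1 - p) ^ (α - ((m + 1 : ℕ) : ℝ)) * (1 - p) := by
    conv_rhs => rw [← Real.rpow_add_one hq.ne']
    congr 1; push_cast; ring
  rw [pbWeight, pbWeight, h1]
  linear_combination (1 - p) * p ^ (m + 1) * (1 - p) ^ (α - ((m + 1 : ℕ) : ℝ)) * succ_mul_choose α m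

lemma pbWeight_pos (hα : 0 ≤ α) (hp : 0 < p) (hp1 : p < 1) {m : ℕ} (hm : m ≤ ⌊α⌋₊) :
    0 < pbWeight α p m := by
  have hq : 0 < 1 - p := by linarith
  induction m with
  | zero => simp [pbWeight, Real.rpow_pos_of_pos hq]
  | succ m ih =>
    have h1 : (m : ℝ) + 1 ≤ α := by
      have := (Nat.le_floor_iff hα).1 hm
      push_cast at this; exact this
    have h2 := pbWeight_succ (α := α) hp1 m
    have h3 : 0 < (α - m) * p * pbWeight α p m :=
      mul_pos (mul_pos (by linarith) hp) (ih (by omega))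
    rw [← h2] at h3
    exact pos_of_mul_pos_right h3 (by positivity)

lemma pbConst_pos (hα : 0 ≤ α) (hp : 0 < p) (hp1 : p < 1) : 0 < pbConst α p :=
  sum_pos (fun m hm => pbWeight_pos hα hp hp1 (by have := mem_range.1 hm; omega)) (by simp)

lemma pseudoBinomial_real (hα : 0 ≤ α) (hp : 0 < p) (hp1 : p < 1) (S : Set ℕ) :
    (pseudoBinomial α p).real S
      = ∑ m ∈ range (⌊α⌋₊ + 1), pbWeight α p m / pbConst α p * S.indicator 1 m := by
  have hS : MeasurableSet S := MeasurableSet.of_discrete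
  rw [measureReal_def, pseudoBinomial, Measure.finsetSum_apply, ENNReal.toReal_sum]
  · refine sum_congr rfl fun m hm => ?_
    have : 0 ≤ pbWeight α p m / pbConst α p :=
      div_nonneg (pbWeight_pos hα hp hp1 (by have := mem_range.1 hm; omega)).le
        (pbConst_pos hα hp hp1).le
    rw [Measure.smul_apply, smul_eq_mul, ENNReal.toReal_mul, ENNReal.toReal_ofReal this,
      Measure.dirac_apply' _ hS]
    by_cases h : m ∈ S <;> simp [h]
  · intro m _
    rw [Measure.smul_apply, smul_eq_mul, Measure.dirac_apply' _ hS]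
    by_cases h : m ∈ S <;> simp [h]

end pseudoBinomial

/-- The one-sided Stein estimate: the two laws differ on a test function by the sum of the first-order
bound and the error at `N`, whose probability is at most `1 / 2`. -/
lemma sum_sub_bernoulliSum_le {N : ℕ} {α p : ℝ} {w : ℕ → ℝ} (hN : 1 ≤ N) (hαN : N ≤ α)
    (hαN' : α ≤ N + 1) (hp : 0 < p) (hp2 : p ≤ 1 / 2) (hw : ∀ m ≤ N, 0 < w m)
    (hbal : ∀ m < N, (m + 1) * (1 - p) * w (m + 1) = (α - m) * p * w m)
    (hsum : ∑ m ∈ range (N + 1), w m = 1) {l : List ℝ} (hl : ∀ t ∈ l, 0 ≤ t ∧ t ≤ 1 / 2)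
    (hmean : l.sum = α * p) {f : ℕ → ℝ} (hf : ∀ m, f m = 0 ∨ f m = 1) :
    ∑ m ∈ range (N + 1), w m * f m - bernoulliSum l f ≤
      1 / ((α + 1) * p * (1 - p)) * (l.map fun t => t * |p - t|).sum
        + (α - N) * p / ((1 - p) * (N + 1)) * (1 / 2) := by
  have hl1 : ∀ t ∈ l, 0 ≤ t ∧ t ≤ 1 := fun t ht => ⟨(hl t ht).1, by linarith [(hl t ht).2]⟩
  have hf01 : ∀ m, 0 ≤ f m ∧ f m ≤ 1 := fun m => by rcases hf m with h | h <;> rw [h] <;> norm_num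
  set g := steinSolution N p w f
  have h1 := abs_bernoulliSum_stein_le hl1 p (g := g)
    fun j hj => abs_steinSolution_sub_le hN hαN hαN' hp hp2 hw hbal hsum hf hj
  rw [hmean] at h1
  have h2 := bernoulliSum_mono hl1
    (sub_le_steinSolution hN hαN hαN' hp (by linarith) hw hbal hsum hf01)
  obtain ⟨M, rfl⟩ : ∃ M, N = M + 1 := ⟨N - 1, by omega⟩
  have h3 := bernoulliSum_single_le_half hl M
  have hneg : ∀ G : ℕ → ℝ, bernoulliSum l (fun m => -G m) = -bernoulliSum l G := by
    intro G
    have := bernoulliSum_const_mul l (-1) G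
    simpa using this
  rw [bernoulliSum_sub, bernoulliSum_const, bernoulliSum_add, hneg, bernoulliSum_const_mul] at h2
  have h4 : 0 ≤ (α - (M + 1 : ℕ)) * p / ((1 - p) * ((M + 1 : ℕ) + 1)) :=
    div_nonneg (mul_nonneg (by linarith) hp.le) (mul_nonneg (by linarith) (by positivity))
  have h5 := mul_le_mul_of_nonneg_left h3 h4
  have h6 := (abs_le.1 h1).1
  linarith

/-- The triangle inequality through `b`, an upper bound of all the parameters. -/
lemma sum_map_mul_abs_sub_le {l : List ℝ} {b : ℝ} (hl : ∀ t ∈ l, 0 ≤ t ∧ t ≤ b) (p : ℝ) :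
    (l.map fun t => t * |p - t|).sum
      ≤ l.sum * |b - p| + (b * l.sum - (l.map fun t => t ^ 2).sum) := by
  induction l with
  | nil => simp
  | cons t l ih =>
    have ht := hl t (by simp)
    have i := ih fun x hx => hl x (by simp [hx])
    simp only [List.map_cons, List.sum_cons]
    have : |p - t| ≤ |b - p| + (b - t) := by
      have := abs_sub_le p b t
      rwa [abs_sub_comm p b, abs_of_nonneg (show 0 ≤ b - t by linarith)] at this
    have := mul_le_mul_of_nonneg_left this ht.1
    nlinarith

/-- The error of the Stein inequality at `N` is absorbed when the constant `1 / ((α + 1) p (1 - p))` is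
relaxed to `1 / (N p (1 - p))`. -/
lemma error_le {N : ℕ} {α p E : ℝ} (hN : 1 ≤ N) (hαN : N ≤ α) (hp : 0 < p) (hp1 : p < 1)
    (hαN' : α ≤ N + 1) (hE : α * p * (p / 4) ≤ E) :
    1 / ((α + 1) * p * (1 - p)) * E + (α - N) * p / ((1 - p) * (N + 1)) * (1 / 2)
      ≤ 1 / (N * p * (1 - p)) * E := by
  have hN1 : (1 : ℝ) ≤ N := by exact_mod_cast hN
  have hq : 0 < 1 - p := by linarith
  have hα : 0 < α := by linarith
  have hαp : 0 < α * p := mul_pos hα hp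
  obtain ⟨Q, rfl⟩ : ∃ Q, E = α * p * Q := ⟨E / (α * p), by field_simp⟩
  have hQ : p / 4 ≤ Q := le_of_mul_le_mul_left hE hαp
  have e : 1 / (N * p * (1 - p)) * (α * p * Q)
      - (1 / ((α + 1) * p * (1 - p)) * (α * p * Q)
        + (α - N) * p / ((1 - p) * (N + 1)) * (1 / 2))
      = ((α + 1 - N) * (α / (N * (α + 1))) * Q - (α - N) * p / (2 * (N + 1))) / (1 - p) := by
    field_simp; ring
  have h1 : 1 / ((N : ℝ) + 1) ≤ α / (N * (α + 1)) := by
    rw [div_le_div_iff₀ (by positivity) (by positivity)]; nlinarith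
  have h2 : 2 * (α - N) * (1 / ((N : ℝ) + 1)) * (p / 4) ≤ (α + 1 - N) * (α / (N * (α + 1))) * Q :=
    mul_le_mul (mul_le_mul (by linarith) h1 (by positivity) (by linarith)) hQ (by positivity)
      (mul_nonneg (by linarith) (by positivity))
  have h3 : 2 * (α - N) * (1 / ((N : ℝ) + 1)) * (p / 4) = (α - N) * p / (2 * (N + 1)) := by
    field_simp; ring
  have : 0 ≤ ((α + 1 - N) * (α / (N * (α + 1))) * Q - (α - N) * p / (2 * (N + 1))) / (1 - p) :=
    div_nonneg (by linarith) hq.le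
  linarith

end

/-! ### Comparison of the two laws -/

section
open Finset

/-- The trials may be replaced by measurable versions with values in `{0, 1}` everywhere. -/
lemma exists_measurable_zero_one_version {Ω : Type*} [MeasurableSpace Ω] {μ : Measure Ω} {n : ℕ}
    {p : unitInterval} {ξ : ℕ → Ω → ℕ}
    (hlaw : ∀ l ∈ Icc 1 n, HasLaw (ξ l) (bernoulliMeasure (1 : ℕ) 0 p) μ) :
    ∃ ξ' : ℕ → Ω → ℕ, (∀ l, Measurable (ξ' l)) ∧ (∀ l ω, ξ' l ω ≤ 1) ∧
      ∀ l ∈ Icc 1 n, ξ l =ᵐ[μ] ξ' l := by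
  classical
  refine ⟨fun l ω => if hl : l ∈ Icc 1 n then min 1 ((hlaw l hl).aemeasurable.mk _ ω) else 0,
    fun l => ?_, fun l ω => ?_, fun l hl => ?_⟩
  · by_cases hl : l ∈ Icc 1 n
    · simp only [dif_pos hl]
      exact measurable_const.min (hlaw l hl).aemeasurable.measurable_mk
    · simp only [dif_neg hl]; exact measurable_const
  · dsimp only; split_ifs <;> omega
  · have h1 : ∀ᵐ ω ∂μ, ξ l ω ≤ 1 := by
      have h := (hlaw l hl).measure_eq (p := fun x => ¬ x ≤ 1) MeasurableSet.of_discrete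
      rw [ae_iff, h, bernoulliMeasure_apply_of_notMem_of_notMem _ MeasurableSet.of_discrete] <;>
        simp
    filter_upwards [h1, (hlaw l hl).aemeasurable.ae_eq_mk] with ω h1 h2
    rw [dif_pos hl, ← h2]
    omega

lemma map_runCount_real_eq_bernoulliSum {Ω : Type*} [MeasurableSpace Ω] {μ : Measure Ω}
    [IsProbabilityMeasure μ] {n k₁ k₂ : ℕ} (hk₁ : 1 ≤ k₁) (hk₂ : 1 ≤ k₂) {p : unitInterval}
    {ξ : ℕ → Ω → ℕ} (hlaw : ∀ l ∈ Icc 1 n, HasLaw (ξ l) (bernoulliMeasure (1 : ℕ) 0 p) μ)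
    (hindep : iIndepFun (fun l : Icc 1 n => ξ l) μ) {s : List ℝ}
    (hs : runPoly (k₁ + k₂) n
      = (s.map fun x => 1 + Polynomial.C x * (Polynomial.X : Polynomial ℝ)).prod) :
    AEMeasurable (runCount n k₁ k₂ ξ) μ ∧ ∀ S : Set ℕ,
      (μ.map (runCount n k₁ k₂ ξ)).real S
        = bernoulliSum (s.map fun x => runProb k₁ k₂ p * x) (S.indicator 1) := by
  obtain ⟨ξ', hm, h01, hae⟩ := exists_measurable_zero_one_version hlaw
  have hlaw' : ∀ l ∈ Icc 1 n, HasLaw (ξ' l) (bernoulliMeasure (1 : ℕ) 0 p) μ :=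
    fun l hl => (hlaw l hl).congr (hae l hl).symm
  have hindep' : iIndepFun (fun l : Icc 1 n => ξ' l) μ :=
    hindep.congr fun l => hae l l.2
  have hcount : runCount n k₁ k₂ ξ =ᵐ[μ] runCount n k₁ k₂ ξ' := by
    have : ∀ᵐ ω ∂μ, ∀ l ∈ Icc 1 n, ξ l ω = ξ' l ω :=
      (Filter.eventually_all_finset _).2 hae
    filter_upwards [this] with ω hω
    exact runCount_congr hω
  have hmc := measurable_runCount (k₁ := k₁) (k₂ := k₂) hm n
  refine ⟨hmc.aemeasurable.congr hcount.symm, fun S => ?_⟩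
  have hone : ∀ l ∈ Icc 1 n, μ.real (ξ' l ⁻¹' {1}) = p := by
    intro l hl
    have := (hlaw' l hl).measureReal_eq (p := fun x => x = 1) MeasurableSet.of_discrete
    rw [bernoulliMeasure_real_apply _ MeasurableSet.of_discrete] at this
    simpa [Set.preimage] using this
  have hzero : ∀ l ∈ Icc 1 n, μ.real (ξ' l ⁻¹' {0}) = 1 - p := by
    intro l hl
    have := (hlaw' l hl).measureReal_eq (p := fun x => x = 0) MeasurableSet.of_discrete
    rw [bernoulliMeasure_real_apply _ MeasurableSet.of_discrete] at this
    simpa [Set.preimage] using this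
  have hS : MeasurableSet S := MeasurableSet.of_discrete
  rw [bernoulliSum_eq_aeval, ← hs, ← integral_comp_runCount_eq_aeval hk₁ hk₂ hm h01 hindep' hone
    hzero le_rfl, Measure.map_congr hcount, map_measureReal_apply hmc hS,
    ← integral_indicator_one (hmc hS)]
  rfl

/-- Taking complements turns a one-sided bound over all sets into a two-sided one. -/
lemma real_le_of_forall_sub_le {P Q : Measure ℕ} [IsProbabilityMeasure P] [IsProbabilityMeasure Q]
    {R : ℝ} (h : ∀ S : Set ℕ, Q.real S - P.real S ≤ R) : dTV P Q ≤ R := by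
  have : Nonempty {S : Set ℕ // MeasurableSet S} := ⟨⟨∅, MeasurableSet.empty⟩⟩
  refine ciSup_le fun S => abs_le.2 ⟨by linarith [h S], ?_⟩
  have hc := h (S : Set ℕ)ᶜ
  rw [probReal_compl_eq_one_sub S.2, probReal_compl_eq_one_sub S.2] at hc
  linarith

lemma dTV_le_one (P Q : Measure ℕ) [IsProbabilityMeasure P] [IsProbabilityMeasure Q] :
    dTV P Q ≤ 1 :=
  real_le_of_forall_sub_le fun S => by
    have := measureReal_le_one (μ := Q) (s := S)
    have := measureReal_nonneg (μ := P) (s := S)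
    linarith

lemma pseudoBinomial_real_sub_bernoulliSum_le {α p b : ℝ} (hα : 1 ≤ α) (hp : 0 < p)
    (hp2 : p ≤ 1 / 2) (hb : b ≤ 1 / 2) {l : List ℝ} (hl : ∀ t ∈ l, 0 ≤ t ∧ t ≤ b)
    (hmean : l.sum = α * p)
    (hT : α * p * (b / 4) ≤ b * l.sum - (l.map fun t => t ^ 2).sum) (S : Set ℕ) :
    (pseudoBinomial α p).real S - bernoulliSum l (S.indicator 1) ≤
      1 / (⌊α⌋₊ * p * (1 - p)) *
        (α * p * |b - p| + (b * l.sum - (l.map fun t => t ^ 2).sum)) := by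
  have hα0 : 0 ≤ α := by linarith
  have hp1 : p < 1 := by linarith
  have hN : 1 ≤ ⌊α⌋₊ := (Nat.le_floor_iff hα0).2 (by simpa using hα)
  have hαN : (⌊α⌋₊ : ℝ) ≤ α := Nat.floor_le hα0
  have hαN' : α ≤ ⌊α⌋₊ + 1 := (Nat.lt_floor_add_one α).le
  have hαp : 0 < α * p := by positivity
  have hC := pbConst_pos hα0 hp hp1
  have hmain := sum_sub_bernoulliSum_le (w := fun m => pbWeight α p m / pbConst α p) hN hαN
    hαN' hp hp2 (fun m hm => div_pos (pbWeight_pos hα0 hp hp1 hm) hC)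
    (fun m _ => by rw [← mul_div_assoc, pbWeight_succ hp1, mul_div_assoc])
    (by rw [← Finset.sum_div]; exact div_self hC.ne')
    (fun t ht => ⟨(hl t ht).1, (hl t ht).2.trans hb⟩) hmean
    (f := S.indicator 1) (fun m => by by_cases h : m ∈ S <;> simp [h])
  have hsum := sum_map_mul_abs_sub_le hl p
  rw [← pseudoBinomial_real hα0 hp hp1] at hmain
  rw [hmean] at hsum hT ⊢
  have hE : α * p * (p / 4) ≤ α * p * |b - p| + (b * (α * p) - (l.map fun t => t ^ 2).sum) := by
    have h1 : p ≤ b + |b - p| := by have := neg_le_abs (b - p); linarith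
    have h2 := mul_le_mul_of_nonneg_left h1 hαp.le
    have h3 := mul_nonneg hαp.le (abs_nonneg (b - p))
    linarith
  have hq : 0 < 1 - p := by linarith
  have h3 : 0 ≤ 1 / ((α + 1) * p * (1 - p)) := by positivity
  exact hmain.trans ((add_le_add_left (mul_le_mul_of_nonneg_left hsum h3) _).trans
    (error_le hN hαN hp hp1 hαN' hE))

end

end PseudoBinomialRuns

open PseudoBinomialRuns

theorem mainTheorem1 {Ω Ω' : Type*} [MeasurableSpace Ω] [MeasurableSpace Ω']
    (μ : Measure Ω) [IsProbabilityMeasure μ] (ν : Measure Ω') [IsProbabilityMeasure ν]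
    (n k₁ k₂ k : ℕ) (hk₁ : 1 ≤ k₁) (hk₂ : 1 ≤ k₂) (hk : k = k₁ + k₂) (hn : 2 * k ≤ n)
    (p : unitInterval) (ξ : ℕ → Ω → ℕ)
    (hlaw : ∀ l ∈ Finset.Icc 1 n, HasLaw (ξ l) (bernoulliMeasure (1 : ℕ) 0 p) μ)
    (hindep : iIndepFun (fun l : Finset.Icc 1 n => ξ l) μ)
    (a pt : ℝ) (ha : a = PseudoBinomialRuns.runProb k₁ k₂ p)
    (hpt : pt = k * a * PseudoBinomialRuns.kStar k) (hpt_lt : pt < 1 / 2)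
    (α pc qc : ℝ) (hα : 1 ≤ α) (hpc_pos : 0 < pc) (hpc_lt : pc < 1) (hqc : qc = 1 - pc)
    (hmean : α * pc = ((n : ℝ) - k + 1) * a)
    (Z : Ω' → ℕ) (hZ : HasLaw Z (PseudoBinomialRuns.pseudoBinomial α pc) ν) :
    PseudoBinomialRuns.dTV (μ.map (PseudoBinomialRuns.runCount n k₁ k₂ ξ)) (ν.map Z) ≤
      a / ((⌊α⌋₊ : ℝ) * pc * qc) *
        (((n : ℝ) * (2 * PseudoBinomialRuns.kStar k - 1) + k - 1) * (|pt - pc| / (1 - 2 * pt)) +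
          ((n : ℝ) * (k * (PseudoBinomialRuns.kStar k - 2) + 1)
            - k * (k - 1) * PseudoBinomialRuns.kStar k + 3 * (k : ℝ) ^ 2 - 4 * k + 1) * a) := by
  have hk2 : 2 ≤ k := by omega
  have hkR : (2 : ℝ) ≤ k := by exact_mod_cast hk2
  have hnR : 2 * (k : ℝ) ≤ n := by exact_mod_cast hn
  have hks := two_le_kStar hk2
  have hM : (0 : ℝ) < (n : ℝ) - k + 1 := by linarith
  have hαp : 0 < α * pc := mul_pos (by linarith) hpc_pos
  have ha0 : 0 < a := pos_of_mul_pos_right (hmean ▸ hαp) hM.le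
  have hα0 : 0 ≤ α := by linarith
  subst hqc
  set N := ⌊α⌋₊
  have hN : 1 ≤ N := (Nat.le_floor_iff hα0).2 (by simpa using hα)
  have hN1 : (1 : ℝ) ≤ N := by exact_mod_cast hN
  have hαN : (N : ℝ) ≤ α := Nat.floor_le hα0
  have hq : 0 < 1 - pc := by linarith
  have hNpq : 0 < (N : ℝ) * pc * (1 - pc) := by positivity
  obtain ⟨s, hs, hpoly, hs1, hs2⟩ := exists_runPoly_eq_prod hk2 hn
  rw [hk] at hpoly
  obtain ⟨hmB, hB⟩ := map_runCount_real_eq_bernoulliSum hk₁ hk₂ hlaw hindep hpoly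
  rw [← ha] at hB
  have : IsProbabilityMeasure (μ.map (runCount n k₁ k₂ ξ)) := Measure.isProbabilityMeasure_map hmB
  have : IsProbabilityMeasure (ν.map Z) := Measure.isProbabilityMeasure_map hZ.aemeasurable
  set l := s.map fun x => a * x with hl
  have hlpt : ∀ t ∈ l, 0 ≤ t ∧ t ≤ pt := by
    intro t ht
    obtain ⟨x, hx, rfl⟩ := List.mem_map.1 ht
    refine ⟨mul_nonneg ha0.le (hs x hx).1, ?_⟩
    have := mul_le_mul_of_nonneg_left (hs x hx).2 ha0.le
    rw [hpt]; linarith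
  have hlsum : l.sum = α * pc := by
    rw [hl, List.sum_map_mul_left, List.map_id', hs1, hmean]; ring
  have hlsq : (l.map fun t => t ^ 2).sum
      = a ^ 2 * (((n : ℝ) - k + 1) * (2 * k - 1) - k * (k - 1)) := by
    rw [hl, List.map_map, ← hs2, ← List.sum_map_mul_left]
    simp [Function.comp_def, mul_pow]
  set T := pt * l.sum - (l.map fun t => t ^ 2).sum with hT
  have hTA : T = a * (((n : ℝ) * (k * (kStar k - 2) + 1)
      - k * (k - 1) * kStar k + 3 * (k : ℝ) ^ 2 - 4 * k + 1) * a) := by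
    rw [hT, hlsq, hlsum, hmean, hpt]; ring
  have hpt0 : 0 < pt := by rw [hpt]; positivity
  have hTlow : α * pc * (pt / 4) ≤ T := by
    have h1 := mul_le_mul_of_nonneg_left (two_mul_sub_one_le hk2)
      (show 0 ≤ a ^ 2 * ((n : ℝ) - k + 1) by positivity)
    have h2 : 0 ≤ a ^ 2 * ((k : ℝ) * (k - 1)) :=
      mul_nonneg (sq_nonneg a) (mul_nonneg (by linarith) (by linarith))
    rw [hT, hlsq, hlsum, hmean, hpt]
    linarith
  have hT0 : 0 ≤ T := le_trans (by positivity) hTlow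
  set X := |pt - pc| with hX
  have hX0 : 0 ≤ X := abs_nonneg _
  have h2pt : 0 < 1 - 2 * pt := by linarith
  have hA1 : 2 * ((n : ℝ) - k + 1) ≤ (n : ℝ) * (2 * kStar k - 1) + k - 1 := by
    have : (n : ℝ) * 3 ≤ (n : ℝ) * (2 * kStar k - 1) :=
      mul_le_mul_of_nonneg_left (by linarith) (by positivity)
    linarith
  have hRHS : a / ((N : ℝ) * pc * (1 - pc)) *
        (((n : ℝ) * (2 * kStar k - 1) + k - 1) * (X / (1 - 2 * pt)) +
          ((n : ℝ) * (k * (kStar k - 2) + 1)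
            - k * (k - 1) * kStar k + 3 * (k : ℝ) ^ 2 - 4 * k + 1) * a)
      = 1 / ((N : ℝ) * pc * (1 - pc)) *
        (a * ((n : ℝ) * (2 * kStar k - 1) + k - 1) * (X / (1 - 2 * pt)) + T) := by
    rw [hTA]; ring
  have hXd0 : 0 ≤ X / (1 - 2 * pt) := div_nonneg hX0 h2pt.le
  have hlow : 2 * (α * pc) * (X / (1 - 2 * pt)) + T
      ≤ a * ((n : ℝ) * (2 * kStar k - 1) + k - 1) * (X / (1 - 2 * pt)) + T := by
    have := mul_le_mul_of_nonneg_right (mul_le_mul_of_nonneg_left hA1 ha0.le) hXd0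
    rw [hmean]
    linarith
  rw [hRHS]
  refine le_trans ?_ (mul_le_mul_of_nonneg_left hlow (one_div_pos.2 hNpq).le)
  rcases le_or_gt pc (1 / 2) with hpc2 | hpc2
  · refine real_le_of_forall_sub_le fun S => ?_
    rw [hZ.map_eq, hB]
    refine (pseudoBinomial_real_sub_bernoulliSum_le hα hpc_pos hpc2 hpt_lt.le hlpt hlsum
      hTlow S).trans (mul_le_mul_of_nonneg_left ?_ (one_div_pos.2 hNpq).le)
    have hXX : X ≤ X / (1 - 2 * pt) := le_div_self hX0 h2pt (by linarith)
    have h1 := mul_le_mul_of_nonneg_left hXX hαp.le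
    have h2 := mul_nonneg hαp.le hXd0
    linarith
  · -- For `pc > 1 / 2` the first summand alone makes the bound exceed `1`.
    refine (dTV_le_one _ _).trans ?_
    have h1 : 1 / 2 ≤ X / (1 - 2 * pt) := by
      rw [le_div_iff₀ h2pt]
      have := neg_le_abs (pt - pc)
      linarith
    have h2 := mul_le_mul_of_nonneg_left h1 hαp.le
    rw [one_div, inv_mul_eq_div, le_div_iff₀ hNpq]
    have h3 : (N : ℝ) * pc ≤ α * pc := mul_le_mul_of_nonneg_right hαN hpc_pos.le
    have h4 : (N : ℝ) * pc * (1 - pc) ≤ (N : ℝ) * pc * 1 :=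
      mul_le_mul_of_nonneg_left (by linarith) (by positivity)
    linarith
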